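/- Let $n\ge 2$ and let $\Omega\subseteq\mathbb R^n$ be open (for instance $\Omega=\mathbb R^n$). Consider the mechanical port-Hamiltonian system with $n-2$ Pfaffian constraints $G_c^\top(q)\dot q=0$ and two inputs, $$\dot q=\nabla_{p_0}\mathcal H_0,\qquad \dot p_0=-\nabla_q\mathcal H_0-D_0\nabla_{p_0}\mathcal H_0+G_0u+G_c\lambda,\qquad \mathcal H_0=\tfrac12p_0^\top M_0^{-1}(q)p_0+\mathcal V(q),\qquad q\in\Omega,$$ where $M_0(q)=M_0^\top(q)>0$, $D_0(p_0,q)=D_0^\top(p_0,q)\ge0$ and $\mathcal V$ are smooth, $G_c(q)\in\mathbb R^{n\times(n-2)}$ has full rank and $[G_0(q)\ G_c(q)]\in\mathbb R^{n\times n}$ has full rank. Let $Q(q)\in\mathbb R^{n\times2}$ be smooth of rank $2$ with $Q^\top G_c=0$. Eliminating the multipliers gives the reduced system with momentum $p\in\mathbb R^2$ and $$M=Q^\top M_0Q,\quad p_0=M_0QM^{-1}p,\quad G=Q^\top G_0,\quad D=Q^\top D_0(p_0,q)Q,\quad C=Q^\top\Big\{\tfrac{\partial^\top}{\partial q}[M_0QM^{-1}p]-\tfrac{\partial}{\partial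 q}[M_0QM^{-1}p]\Big\}Q .$$ Let $f_z:\Omega\to\mathbb R^n$ be a diffeomorphism with $f_z^{-1}(0)=0$, write $z=f_z(q)$, let $M_z,C_z,D_z,G_z,\mathcal V_z$ be $M,C,D,G,\mathcal V$ evaluated at $q=f_z^{-1}(z)$, and $Q_z(z)=\frac{\partial f_z}{\partial q}Q\big|_{q=f_z^{-1}(z)}$. Assume that the system has a chained structure: for all $z\in\mathbb R^n$ and $j=1,\dots,n-2$, (row $j+2$ of $Q_z(z)$) $=z_{j+1}\cdot$ (row $1$ of $Q_z(z)$); that is, $Q_z^\perp Q_z=0$ for the $(n-2)\times n$ matrix $Q_z^\perp(z)$ whose $j$-th row has $-z_{j+1}$ in column $1$, $1$ in column $j+2$ and $0$ elsewhere. Let $f_w:z\mapsto w$, for $z_1\ne0$, be the inverse on $\{w_1\neq0\}$ of the map $z=f_w^{-1}(w)$, $$z_1=w_1,\qquad z_2=w_1w_2+\sum_{i=3}^n\frac{w_1^{i-2}}{(i-2)!}w_i,\qquad z_j=\sum_{i=3}^n\frac{w_1^{i+j-4}}{(i+j-4)!}w_i\quad(3\le j\le n).$$ Let $M_w,C_w,D_w,G_w,\mathcal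 V_w$ be $M_z,C_z,D_z,G_z,\mathcal V_z$ evaluated at $z=f_w^{-1}(w)$, $Q_w=\frac{\partial f_w}{\partial z}Q_z\big|_{z=f_w^{-1}(w)}$ and $\mathcal H_w=\frac12p^\top M_w^{-1}p+\mathcal V_w$. For $w_1\neq 0$ the system in the coordinates $(w,p)$ is $$\dot w=Q_w\nabla_p\mathcal H_w,\qquad \dot p=-Q_w^\top\nabla_w\mathcal H_w+(C_w-D_w)\nabla_p\mathcal H_w+G_wu .$$ Let $\hat D\in\mathbb R^{2\times2}$ be symmetric positive definite, $k>0$, $L=\operatorname{diag}(l_1,\dots,l_n)$ with all $l_i>0$, $e_1$ the first standard basis vector of $\mathbb R^n$, and apply the control law $$u=-G_w^{-1}\Big\{Q_w^\top[Lw-\nabla_w\mathcal V_w]+\Big[\hat D+\frac k{w_1^2}Q_w^\top e_1e_1^\top Q_w\Big]\nabla_p\mathcal H_w\Big\}.$$ Then: 1. For $w_1\ne0$ the closed loop has the form $$\dot w=Q_w\nabla_p\mathcal H_d,\qquad \dot p=-Q_w^\top\nabla_w\mathcal H_d+(C_w-D_d)\nabla_p\mathcal H_d,\qquad(\ast)$$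 with $\mathcal H_d=\frac12p^\top M_w^{-1}p+\frac12w^\top Lw$ and $D_d=D_w+\hat D+\frac k{w_1^2}Q_w^\top e_1e_1^\top Q_w$. 2. For every $t_0$ and every initial condition with $w_1(t_0)\ne0$, the closed loop $(\ast)$ has a solution on $[t_0,\infty)$, and every solution on an interval $[t_0,T)$ with the same initial condition coincides with it there. 3. Every solution of $(\ast)$ on $[t_0,\infty)$ with $w_1(t_0)\neq0$ satisfies $w_1(t)\ne0$ for all $t\ge t_0$, $\lim_{t\to\infty}w_1(t)=0$, and $\lim_{t\to\infty}z(t)=0$ for $z(t)=f_w^{-1}(w(t))$. (Here a solution is a continuous curve $(w,p)$ that satisfies $(\ast)$ at every time at which $w_1\ne0$.) -/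

import Mathlib

open Set Filter Topology Matrix
open scoped ContDiff

namespace ChainedPH

noncomputable section

/-- The column of partial derivatives of a scalar function. -/
def grad {m : ℕ} (f : (Fin m → ℝ) → ℝ) (x : Fin m → ℝ) : Fin m → ℝ :=
  fun i => fderiv ℝ f x (Pi.single i 1)

/-- The Jacobian matrix, with entries `∂ gᵢ / ∂ xⱼ`. -/
def jacobian {m l : ℕ} (g : (Fin m → ℝ) → (Fin l → ℝ)) (x : Fin m → ℝ) :
    Matrix (Fin l) (Fin m) ℝ :=
  Matrix.of fun i j => fderiv ℝ g x (Pi.single j 1) i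

/-- A mechanical port-Hamiltonian system with `n = r + 2` degrees of freedom, `r` Pfaffian
constraints `Gcᵀ(q) q̇ = 0` and two inputs,
`q̇ = ∇_{p₀} H₀`, `ṗ₀ = -∇_q H₀ - D₀ ∇_{p₀} H₀ + G₀ u + Gc λ`, `H₀ = ½ p₀ᵀ M₀⁻¹ p₀ + V`,
on an open set `Ω ⊆ ℝⁿ` of configurations (possibly all of `ℝⁿ`). -/
structure NonholonomicSystem (r : ℕ) where
  Ω : Set (Fin (r + 2) → ℝ)
  isOpen_Ω : IsOpen Ω
  /-- mass matrix -/
  M₀ : (Fin (r + 2) → ℝ) → Matrix (Fin (r + 2)) (Fin (r + 2)) ℝ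
  /-- damping matrix `D₀(p₀, q)` -/
  D₀ : (Fin (r + 2) → ℝ) → (Fin (r + 2) → ℝ) → Matrix (Fin (r + 2)) (Fin (r + 2)) ℝ
  /-- input matrix -/
  G₀ : (Fin (r + 2) → ℝ) → Matrix (Fin (r + 2)) (Fin 2) ℝ
  /-- constraint matrix -/
  Gc : (Fin (r + 2) → ℝ) → Matrix (Fin (r + 2)) (Fin r) ℝ
  /-- potential energy -/
  V : (Fin (r + 2) → ℝ) → ℝ
  contDiffOn_M₀ : ∀ i j, ContDiffOn ℝ ∞ (fun q => M₀ q i j) Ω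
  contDiffOn_D₀ : ∀ i j, ContDiffOn ℝ ∞
    (fun x : (Fin (r + 2) → ℝ) × (Fin (r + 2) → ℝ) => D₀ x.1 x.2 i j) (univ ×ˢ Ω)
  contDiffOn_V : ContDiffOn ℝ ∞ V Ω
  posDef_M₀ : ∀ q ∈ Ω, (M₀ q).PosDef
  posSemidef_D₀ : ∀ p₀, ∀ q ∈ Ω, (D₀ p₀ q).PosSemidef
  rank_Gc : ∀ q ∈ Ω, (Gc q).rank = r
  rank_G₀_Gc : ∀ q ∈ Ω, (Matrix.fromCols (G₀ q) (Gc q)).rank = r + 2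

/-- The choices made when the multipliers are eliminated and the configuration is changed to
`z = f_z(q)`: a left annihilator `Gc^⊥ = Qᵀ` of `Gc` of rank two, and a diffeomorphism `f_z` of the
configuration space onto `ℝⁿ` with `f_z⁻¹(0) = 0`. -/
structure Coordinates {r : ℕ} (S : NonholonomicSystem r) where
  Q : (Fin (r + 2) → ℝ) → Matrix (Fin (r + 2)) (Fin 2) ℝ
  contDiffOn_Q : ∀ i j, ContDiffOn ℝ ∞ (fun q => Q q i j) S.Ω
  annihilates : ∀ q ∈ S.Ω, (Q q)ᵀ * S.Gc q = 0
  rank_Q : ∀ q ∈ S.Ω, (Q q).rank = 2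
  fz : OpenPartialHomeomorph (Fin (r + 2) → ℝ) (Fin (r + 2) → ℝ)
  source_fz : fz.source = S.Ω
  target_fz : fz.target = univ
  contDiffOn_fz : ContDiffOn ℝ ∞ fz S.Ω
  contDiff_fz_symm : ContDiff ℝ ∞ fz.symm
  fz_symm_zero : fz.symm 0 = 0

/-- The inverse `z = f_w⁻¹(w)` of the discontinuous coordinate transformation. Indices are shifted
by one: `w 0` is `w₁`, and `w i.succ.succ` for `i = 0, …, r - 1` is `w_{i+3}`. -/
def fwInv {r : ℕ} (w : Fin (r + 2) → ℝ) : Fin (r + 2) → ℝ := fun j =>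
  if j = 0 then w 0
  else if j = 1 then
    w 0 * w 1 + ∑ i : Fin r,
      1 / (Nat.factorial ((i : ℕ) + 1) : ℝ) * w 0 ^ ((i : ℕ) + 1) * w i.succ.succ
  else ∑ i : Fin r,
      1 / (Nat.factorial ((i : ℕ) + (j : ℕ)) : ℝ) * w 0 ^ ((i : ℕ) + (j : ℕ)) * w i.succ.succ

/-- The transformation `w = f_w(z)`, defined implicitly by `fwInv`. For `z₁ ≠ 0` there is exactly
one `w` with `fwInv w = z`; other values of `z` are never used. -/
def fw {r : ℕ} : (Fin (r + 2) → ℝ) → (Fin (r + 2) → ℝ) := Function.invFun fwInv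

/-- The `(n - 2) × n` matrix whose `j`-th row has `-z_{j+1}` in the first column, `1` in column
`j + 2` and zeros elsewhere (`j = 1, …, n - 2`). -/
def chainedAnnihilator {r : ℕ} (z : Fin (r + 2) → ℝ) : Matrix (Fin r) (Fin (r + 2)) ℝ :=
  Matrix.of fun j c =>
    if c = 0 then - z j.castSucc.succ else if c = j.succ.succ then 1 else 0

/-- The first standard basis vector of `ℝⁿ`. -/
def e₁ (r : ℕ) : Fin (r + 2) → ℝ := Pi.single 0 1

namespace Coordinates

variable {r : ℕ} {S : NonholonomicSystem r} (R : Coordinates S)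

/-! The reduced system without multipliers, in the coordinates `(q, p)` with `p ∈ ℝ²`. -/

/-- `M = Qᵀ M₀ Q` -/
def M (q : Fin (r + 2) → ℝ) : Matrix (Fin 2) (Fin 2) ℝ := (R.Q q)ᵀ * S.M₀ q * R.Q q

/-- `p₀ = M₀ Q (Qᵀ M₀ Q)⁻¹ p` -/
def p₀ (p : Fin 2 → ℝ) (q : Fin (r + 2) → ℝ) : Fin (r + 2) → ℝ :=
  (S.M₀ q * R.Q q * (R.M q)⁻¹) *ᵥ p

/-- `G = Qᵀ G₀` -/
def G (q : Fin (r + 2) → ℝ) : Matrix (Fin 2) (Fin 2) ℝ := (R.Q q)ᵀ * S.G₀ q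

/-- `D = Qᵀ D₀ Q` -/
def D (p : Fin 2 → ℝ) (q : Fin (r + 2) → ℝ) : Matrix (Fin 2) (Fin 2) ℝ :=
  (R.Q q)ᵀ * S.D₀ (R.p₀ p q) q * R.Q q

/-- `C = Qᵀ { (∂p₀/∂q)ᵀ - ∂p₀/∂q } Q` -/
def C (p : Fin 2 → ℝ) (q : Fin (r + 2) → ℝ) : Matrix (Fin 2) (Fin 2) ℝ :=
  (R.Q q)ᵀ * ((jacobian (R.p₀ p) q)ᵀ - jacobian (R.p₀ p) q) * R.Q q

/-! The reduced system in the coordinates `(z, p)`, `z = f_z(q)`. -/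

def Mz (z : Fin (r + 2) → ℝ) : Matrix (Fin 2) (Fin 2) ℝ := R.M (R.fz.symm z)

def Vz (z : Fin (r + 2) → ℝ) : ℝ := S.V (R.fz.symm z)

def Qz (z : Fin (r + 2) → ℝ) : Matrix (Fin (r + 2)) (Fin 2) ℝ :=
  jacobian R.fz (R.fz.symm z) * R.Q (R.fz.symm z)

def Cz (p : Fin 2 → ℝ) (z : Fin (r + 2) → ℝ) : Matrix (Fin 2) (Fin 2) ℝ := R.C p (R.fz.symm z)

def Dz (p : Fin 2 → ℝ) (z : Fin (r + 2) → ℝ) : Matrix (Fin 2) (Fin 2) ℝ := R.D p (R.fz.symm z)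

def Gz (z : Fin (r + 2) → ℝ) : Matrix (Fin 2) (Fin 2) ℝ := R.G (R.fz.symm z)

/-- The system has a chained structure: `chainedAnnihilator` is a left annihilator of `Q_z`. -/
def HasChainedStructure : Prop := ∀ z, chainedAnnihilator z * R.Qz z = 0

/-! The reduced system in the coordinates `(w, p)`, `w = f_w(z)`, defined for `w₁ ≠ 0`. -/

def Mw (w : Fin (r + 2) → ℝ) : Matrix (Fin 2) (Fin 2) ℝ := R.Mz (fwInv w)

def Vw (w : Fin (r + 2) → ℝ) : ℝ := R.Vz (fwInv w)

def Qw (w : Fin (r + 2) → ℝ) : Matrix (Fin (r + 2)) (Fin 2) ℝ :=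
  jacobian fw (fwInv w) * R.Qz (fwInv w)

def Cw (w : Fin (r + 2) → ℝ) (p : Fin 2 → ℝ) : Matrix (Fin 2) (Fin 2) ℝ := R.Cz p (fwInv w)

def Dw (w : Fin (r + 2) → ℝ) (p : Fin 2 → ℝ) : Matrix (Fin 2) (Fin 2) ℝ := R.Dz p (fwInv w)

def Gw (w : Fin (r + 2) → ℝ) : Matrix (Fin 2) (Fin 2) ℝ := R.Gz (fwInv w)

/-- `H_w = ½ pᵀ M_w⁻¹ p + V_w` -/
def Hw (w : Fin (r + 2) → ℝ) (p : Fin 2 → ℝ) : ℝ :=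
  1 / 2 * (p ⬝ᵥ ((R.Mw w)⁻¹ *ᵥ p)) + R.Vw w

/-- The open-loop vector field `(ẇ, ṗ)` with input `u`. -/
def openLoop (w : Fin (r + 2) → ℝ) (p u : Fin 2 → ℝ) : (Fin (r + 2) → ℝ) × (Fin 2 → ℝ) :=
  (R.Qw w *ᵥ grad (fun p' => R.Hw w p') p,
    -((R.Qw w)ᵀ *ᵥ grad (fun w' => R.Hw w' p) w)
      + (R.Cw w p - R.Dw w p) *ᵥ grad (fun p' => R.Hw w p') p + R.Gw w *ᵥ u)

/-- The injected damping `D̂ + (k / w₁²) Q_wᵀ e₁ e₁ᵀ Q_w`. -/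
def injectedDamping (Dhat : Matrix (Fin 2) (Fin 2) ℝ) (k : ℝ) (w : Fin (r + 2) → ℝ) :
    Matrix (Fin 2) (Fin 2) ℝ :=
  Dhat + (k / w 0 ^ 2) •
    ((R.Qw w)ᵀ * Matrix.vecMulVec (e₁ r) (e₁ r) * R.Qw w)

/-- The control law
`u = -G_w⁻¹ { Q_wᵀ [L w - ∇_w V_w] + [D̂ + (k / w₁²) Q_wᵀ e₁ e₁ᵀ Q_w] ∇_p H_w }`,
with `L = diag(l₁, …, lₙ)`. -/
def controlLaw (l : Fin (r + 2) → ℝ) (Dhat : Matrix (Fin 2) (Fin 2) ℝ) (k : ℝ)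
    (w : Fin (r + 2) → ℝ) (p : Fin 2 → ℝ) : Fin 2 → ℝ :=
  -((R.Gw w)⁻¹ *ᵥ ((R.Qw w)ᵀ *ᵥ (Matrix.diagonal l *ᵥ w - grad R.Vw w)
      + R.injectedDamping Dhat k w *ᵥ grad (fun p' => R.Hw w p') p))

/-- `H_d = ½ pᵀ M_w⁻¹ p + ½ wᵀ L w` -/
def Hd (l : Fin (r + 2) → ℝ) (w : Fin (r + 2) → ℝ) (p : Fin 2 → ℝ) : ℝ :=
  1 / 2 * (p ⬝ᵥ ((R.Mw w)⁻¹ *ᵥ p)) + 1 / 2 * (w ⬝ᵥ (Matrix.diagonal l *ᵥ w))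

/-- `D_d = D_w + D̂ + (k / w₁²) Q_wᵀ e₁ e₁ᵀ Q_w` -/
def Dd (Dhat : Matrix (Fin 2) (Fin 2) ℝ) (k : ℝ) (w : Fin (r + 2) → ℝ) (p : Fin 2 → ℝ) :
    Matrix (Fin 2) (Fin 2) ℝ :=
  R.Dw w p + R.injectedDamping Dhat k w

/-- The closed-loop vector field
`ẇ = Q_w ∇_p H_d`, `ṗ = -Q_wᵀ ∇_w H_d + (C_w - D_d) ∇_p H_d`. -/
def closedLoop (l : Fin (r + 2) → ℝ) (Dhat : Matrix (Fin 2) (Fin 2) ℝ) (k : ℝ)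
    (w : Fin (r + 2) → ℝ) (p : Fin 2 → ℝ) : (Fin (r + 2) → ℝ) × (Fin 2 → ℝ) :=
  (R.Qw w *ᵥ grad (fun p' => R.Hd l w p') p,
    -((R.Qw w)ᵀ *ᵥ grad (fun w' => R.Hd l w' p) w)
      + (R.Cw w p - R.Dd Dhat k w p) *ᵥ grad (fun p' => R.Hd l w p') p)

/-- `x = (w, p)` is a solution of the closed loop on the time set `J`: it is continuous and
satisfies the differential equation wherever the latter is defined, that is, at every time with
`w₁(t) ≠ 0` (nothing but continuity is asked at times with `w₁(t) = 0`). -/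
def IsSolutionOn (l : Fin (r + 2) → ℝ) (Dhat : Matrix (Fin 2) (Fin 2) ℝ) (k : ℝ)
    (J : Set ℝ) (x : ℝ → (Fin (r + 2) → ℝ) × (Fin 2 → ℝ)) : Prop :=
  ContinuousOn x J ∧
    ∀ t ∈ J, (x t).1 0 ≠ 0 → HasDerivWithinAt x (R.closedLoop l Dhat k (x t).1 (x t).2) J t

end Coordinates

end

end ChainedPH

/-! Since `G_w` is invertible, the control replaces the potential by `½ wᵀ L w` and adds damping.
Along the closed loop `H_d` decreases at rate `vᵀ (D_w + D̂) v + k (ẇ₁ / w₁)²` with `v = M_w⁻¹ p`;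
the skew matrix `C_w` contributes nothing.

Well-posedness. The last term bounds the derivative of `log |w₁|` in mean square by the energy, so
`|w₁|` decays at most exponentially and never reaches zero in finite time (`exp_mul_abs_le_abs`). As
`fwInv` is polynomial, `H_d` is smooth across `w₁ = 0`, and its sublevel sets are compact. On a
bounded time interval a trajectory therefore stays in a compact subset of `{w₁ ≠ 0}`, where the
vector field is `C¹`; this gives global existence and uniqueness.

Convergence. This is a LaSalle argument off the singular set. Let `y` be a cluster point with `w₁ ≠
0`. The energy converges, so its rate vanishes at `y` and `p = 0` there. Hence `p` is eventually
small wherever `|w₁|` is bounded below, so `ṗ` vanishes at `y` too (both steps use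
`rate_eq_zero_of_mapClusterPt`). But at `p = 0` one has `ṗ = -Q_wᵀ L w`, which is nonzero for `w₁ ≠
0` (`transpose_Qw_mulVec_ne_zero`). So `w₁ → 0`. As `w` is bounded and every monomial of `z`
contains a positive power of `w₁`, also `z → 0`.

The force is nonzero because, in the coordinates `w`, the chained constraints freeze `w₃, …, wₙ`
along suitable admissible directions. This rests on the nonsingularity of a Hankel matrix of inverse
factorials (`eq_zero_of_sum_div_factorial_eq_zero`). -/

namespace ChainedPH

/-! ### Autonomous differential equations: existence, uniqueness, cluster points -/

section AutonomousODE

open scoped NNReal Manifold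

variable {E : Type*} [NormedAddCommGroup E] [NormedSpace ℝ E]

/-- A `C¹` vector field on an open set agrees near a compact subset with a globally Lipschitz and
bounded one. -/
theorem exists_lipschitzWith_bounded_eqOn [FiniteDimensional ℝ E] {f : E → E} {U K : Set E}
    (hU : IsOpen U) (hf : ContDiffOn ℝ 1 f U) (hK : IsCompact K) (hKU : K ⊆ U) :
    ∃ (g : E → E) (W : Set E) (C B : ℝ≥0), IsOpen W ∧ K ⊆ W ∧ W ⊆ U ∧ EqOn g f W ∧
      LipschitzWith C g ∧ ∀ x, ‖g x‖ ≤ B := by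
  obtain ⟨L, hL, hKL, hLU⟩ := exists_compact_between hK hU hKU
  obtain ⟨χ, h1, h0, -⟩ := exists_contMDiffMap_one_nhds_of_subset_interior (n := 1) 𝓘(ℝ, E)
    hK.isClosed hKL
  have hχ : ContDiff ℝ 1 χ := χ.contMDiff.contDiff
  let g : E → E := fun x => χ x • f x
  have hsupp : tsupport g ⊆ L := closure_minimal (fun x hx => by
    by_contra hxL
    exact hx (by simp [g, h0 x hxL])) hL.isClosed
  have hgc : HasCompactSupport g := hL.of_isClosed_subset (isClosed_tsupport g) hsupp
  have hg : ContDiff ℝ 1 g := by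
    rw [contDiff_iff_contDiffAt]
    intro x
    by_cases hx : x ∈ U
    · exact hχ.contDiffAt.smul (hf.contDiffAt (hU.mem_nhds hx))
    · have hx' : x ∈ (tsupport g)ᶜ := fun h => hx (hLU (hsupp h))
      have : g =ᶠ[𝓝 x] fun _ => 0 :=
        eventually_of_mem ((isClosed_tsupport g).isOpen_compl.mem_nhds hx')
          fun y hy => image_eq_zero_of_notMem_tsupport hy
      exact contDiffAt_const.congr_of_eventuallyEq this
  obtain ⟨C, hC⟩ := hg.lipschitzWith_of_hasCompactSupport hgc (by simp)
  obtain ⟨B, hB⟩ := hgc.exists_bound_of_continuous hg.continuous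
  obtain ⟨W, hW, hKW, hW1⟩ := eventually_nhdsSet_iff_exists.1 h1
  refine ⟨g, W ∩ U, C, ⟨max B 0, le_max_right _ _⟩, hW.inter hU, subset_inter hKW hKU,
    inter_subset_right, fun x hx => ?_, hC, fun x => (hB x).trans (le_max_left _ _)⟩
  simp [g, hW1 x hx.1]

/-- A bounded, globally Lipschitz autonomous vector field has solutions on every compact time
interval. -/
theorem exists_solution_Icc_of_lipschitzWith [CompleteSpace E] {g : E → E} {C B : ℝ≥0}
    (hg : LipschitzWith C g) (hB : ∀ x, ‖g x‖ ≤ B) {a b : ℝ} (hab : a ≤ b) (x₀ : E) :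
    ∃ x : ℝ → E, x a = x₀ ∧ ∀ t ∈ Icc a b, HasDerivWithinAt x (g (x t)) (Icc a b) t := by
  -- A curve of speed at most `B` moves by at most `B (b - a)`, so a ball of this radius suffices.
  have h : IsPicardLindelof (fun _ => g) (⟨a, left_mem_Icc.2 hab⟩ : Icc a b) x₀
      (B * ⟨b - a, sub_nonneg.2 hab⟩) 0 B C :=
    { lipschitzOnWith := fun _ _ => hg.lipschitzOnWith
      continuousOn := fun _ _ => continuousOn_const
      norm_le := fun _ _ x _ => hB x
      mul_max_le := by
        have : max (b - a) (a - a) = b - a := max_eq_left (by linarith)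
        simp only [this]
        simp only [NNReal.coe_zero, sub_zero]
        exact le_rfl }
  exact h.exists_eq_forall_mem_Icc_hasDerivWithinAt₀

/-- Uniqueness of solutions inside an open set on which the vector field is `C¹`. -/
theorem eqOn_Icc_of_contDiffOn [FiniteDimensional ℝ E] {f : E → E} {U : Set E} (hU : IsOpen U)
    (hf : ContDiffOn ℝ 1 f U) {a b : ℝ} {x y : ℝ → E}
    (hx : ContinuousOn x (Icc a b)) (hxU : ∀ t ∈ Icc a b, x t ∈ U)
    (hx' : ∀ t ∈ Ico a b, HasDerivWithinAt x (f (x t)) (Ici t) t)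
    (hy : ContinuousOn y (Icc a b)) (hyU : ∀ t ∈ Icc a b, y t ∈ U)
    (hy' : ∀ t ∈ Ico a b, HasDerivWithinAt y (f (y t)) (Ici t) t)
    (h : x a = y a) : EqOn x y (Icc a b) := by
  have hK : IsCompact (x '' Icc a b ∪ y '' Icc a b) :=
    (isCompact_Icc.image_of_continuousOn hx).union (isCompact_Icc.image_of_continuousOn hy)
  obtain ⟨g, W, C, B, hW, hKW, hWU, hgf, hg, hB⟩ := exists_lipschitzWith_bounded_eqOn hU hf hK
    (union_subset (image_subset_iff.2 hxU) (image_subset_iff.2 hyU))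
  refine ODE_solution_unique_of_mem_Icc_right (v := fun _ => g) (s := fun _ => univ) (K := C)
    (fun _ _ => hg.lipschitzOnWith) hx (fun t ht => ?_) (fun _ _ => mem_univ _) hy
    (fun t ht => ?_) (fun _ _ => mem_univ _) h
  · rw [hgf (hKW (Or.inl (mem_image_of_mem x (Ico_subset_Icc_self ht))))]
    exact hx' t ht
  · rw [hgf (hKW (Or.inr (mem_image_of_mem y (Ico_subset_Icc_self ht))))]
    exact hy' t ht

theorem hasDerivWithinAt_Ici_of_Icc {F : Type*} [NormedAddCommGroup F] [NormedSpace ℝ F]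
    {x : ℝ → F} {v : F} {a b t : ℝ}
    (ht : t ∈ Ico a b) (h : HasDerivWithinAt x v (Icc a b) t) : HasDerivWithinAt x v (Ici t) t :=
  h.mono_of_mem_nhdsWithin (mem_of_superset (Icc_mem_nhdsGE ht.2) (Icc_subset_Icc_left ht.1))

/-- If every solution up to time `b` stays in a compact subset of the domain, then there is a
solution up to time `b`. -/
theorem exists_solution_Icc_of_apriori [FiniteDimensional ℝ E] {f : E → E} {U K : Set E}
    (hU : IsOpen U) (hf : ContDiffOn ℝ 1 f U) {a b : ℝ} (hab : a ≤ b) {x₀ : E}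
    (hK : IsCompact K) (hKU : K ⊆ U)
    (hap : ∀ s ≤ b, ∀ x : ℝ → E, x a = x₀ → ContinuousOn x (Icc a s) → (∀ t ∈ Ico a s, x t ∈ U) →
      (∀ t ∈ Ico a s, HasDerivWithinAt x (f (x t)) (Ici t) t) → ∀ t ∈ Icc a s, x t ∈ K) :
    ∃ x : ℝ → E, x a = x₀ ∧ (∀ t ∈ Icc a b, x t ∈ U) ∧
      ∀ t ∈ Icc a b, HasDerivWithinAt x (f (x t)) (Icc a b) t := by
  obtain ⟨g, W, C, B, hW, hKW, hWU, hgf, hg, hB⟩ := exists_lipschitzWith_bounded_eqOn hU hf hK hKU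
  have := FiniteDimensional.complete ℝ E
  obtain ⟨x, hxa, hx⟩ := exists_solution_Icc_of_lipschitzWith hg hB hab x₀
  have hxc : ContinuousOn x (Icc a b) := fun t ht => (hx t ht).continuousWithinAt
  have hmem : ∀ t ∈ Icc a b, x t ∈ W := by
    by_contra! hne
    have hcpt : IsCompact (Icc a b ∩ x ⁻¹' Wᶜ) :=
      isCompact_Icc.of_isClosed_subset
        (hxc.preimage_isClosed_of_isClosed isClosed_Icc hW.isClosed_compl) inter_subset_left
    obtain ⟨s, ⟨hs, hsW⟩, hleast⟩ := hcpt.exists_isLeast (by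
      obtain ⟨t, ht, h⟩ := hne
      exact ⟨t, ht, h⟩)
    have hbefore : ∀ t ∈ Ico a s, x t ∈ W := fun t ht => by
      by_contra h
      exact (hleast ⟨⟨ht.1, ht.2.le.trans hs.2⟩, h⟩).not_gt ht.2
    -- Before the first exit time `s` from `W`, the curve solves the equation for `f` itself. The a
    -- priori bound includes the endpoint, so `x s` lies in `K ⊆ W`, a contradiction.
    refine hsW (hKW (hap s hs.2 x hxa (hxc.mono (Icc_subset_Icc_right hs.2))
      (fun t ht => hWU (hbefore t ht)) (fun t ht => ?_) s ⟨hs.1, le_rfl⟩))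
    rw [← hgf (hbefore t ht)]
    exact hasDerivWithinAt_Ici_of_Icc ⟨ht.1, ht.2.trans_le hs.2⟩ (hx t ⟨ht.1, ht.2.le.trans hs.2⟩)
  exact ⟨x, hxa, fun t ht => hWU (hmem t ht), fun t ht => hgf (hmem t ht) ▸ hx t ht⟩

/-- If on every bounded time interval all solutions stay in a compact subset of the domain, then
there is a solution for all times. -/
theorem exists_solution_Ici_of_apriori [FiniteDimensional ℝ E] {f : E → E} {U : Set E}
    (hU : IsOpen U) (hf : ContDiffOn ℝ 1 f U) {a : ℝ} {x₀ : E}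
    (hap : ∀ b ≥ a, ∃ K : Set E, IsCompact K ∧ K ⊆ U ∧
      ∀ s ≤ b, ∀ x : ℝ → E, x a = x₀ → ContinuousOn x (Icc a s) → (∀ t ∈ Ico a s, x t ∈ U) →
      (∀ t ∈ Ico a s, HasDerivWithinAt x (f (x t)) (Ici t) t) → ∀ t ∈ Icc a s, x t ∈ K) :
    ∃ x : ℝ → E, x a = x₀ ∧ (∀ t ∈ Ici a, x t ∈ U) ∧
      ∀ t ∈ Ici a, HasDerivWithinAt x (f (x t)) (Ici a) t := by
  have hex : ∀ n : ℕ, ∃ x : ℝ → E, x a = x₀ ∧ (∀ t ∈ Icc a (a + n + 1), x t ∈ U) ∧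
      ∀ t ∈ Icc a (a + n + 1), HasDerivWithinAt x (f (x t)) (Icc a (a + n + 1)) t := fun n => by
    have hn : a ≤ a + n + 1 := by linarith [(Nat.cast_nonneg n : (0 : ℝ) ≤ n)]
    obtain ⟨K, hK, hKU, h⟩ := hap (a + n + 1) hn
    exact exists_solution_Icc_of_apriori hU hf hn hK hKU h
  choose y hya hyU hy using hex
  have hyc : ∀ n, ContinuousOn (y n) (Icc a (a + n + 1)) :=
    fun n t ht => (hy n t ht).continuousWithinAt
  have hagree : ∀ m n : ℕ, ∀ t, a ≤ t → t ≤ a + m + 1 → t ≤ a + n + 1 → y m t = y n t := by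
    intro m n t hat hm hn
    have hyr : ∀ n : ℕ, t ≤ a + n + 1 → ∀ s ∈ Ico a t,
        HasDerivWithinAt (y n) (f (y n s)) (Ici s) s := fun n hn s hs =>
      hasDerivWithinAt_Ici_of_Icc ⟨hs.1, hs.2.trans_le hn⟩ (hy n s ⟨hs.1, hs.2.le.trans hn⟩)
    exact eqOn_Icc_of_contDiffOn hU hf
      ((hyc m).mono (Icc_subset_Icc_right hm)) (fun s hs => hyU m s ⟨hs.1, hs.2.trans hm⟩)
      (hyr m hm)
      ((hyc n).mono (Icc_subset_Icc_right hn)) (fun s hs => hyU n s ⟨hs.1, hs.2.trans hn⟩)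
      (hyr n hn)
      ((hya m).trans (hya n).symm) ⟨hat, le_rfl⟩
  -- The extra `+ 1` makes this strict, so near `t` the glued curve agrees with a single `y n` and
  -- inherits its derivative.
  have hceil : ∀ t, t < a + ⌈t - a⌉₊ + 1 := fun t => by linarith [Nat.le_ceil (t - a)]
  have heq : ∀ n : ℕ, EqOn (fun t => y ⌈t - a⌉₊ t) (y n) (Icc a (a + n + 1)) :=
    fun n t ht => hagree _ _ t ht.1 (hceil t).le ht.2
  refine ⟨fun t => y ⌈t - a⌉₊ t, hya _, fun t ht => hyU _ t ⟨ht, (hceil t).le⟩, fun t ht => ?_⟩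
  have hmem : t ∈ Icc a (a + ⌈t - a⌉₊ + 1) := ⟨ht, (hceil t).le⟩
  refine ((hy ⌈t - a⌉₊ t hmem).congr (heq _) (heq _ hmem)).mono_of_mem_nhdsWithin ?_
  rw [← Ici_inter_Iic, inter_comm]
  exact inter_mem (mem_nhdsWithin_of_mem_nhds (Iic_mem_nhds (hceil t))) self_mem_nhdsWithin

/-- If a function `φ` of the state has rate `ψ` along a trajectory and becomes small whenever the
trajectory is near one of its cluster points, then `ψ` vanishes at this cluster point. -/
theorem rate_eq_zero_of_mapClusterPt {f : E → E} {x : ℝ → E} {a : ℝ} {φ ψ : E → ℝ} {p : E}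
    (hx : ∀ t ≥ a, HasDerivWithinAt x (f (x t)) (Ici t) t) (hxc : ContinuousOn x (Ici a))
    (hφ : ∀ t ≥ a, HasDerivWithinAt (fun s => φ (x s)) (ψ (x t)) (Ici t) t) (hφc : Continuous φ)
    (hf : ContinuousAt f p) (hψ : ContinuousAt ψ p) (hp : MapClusterPt p atTop x)
    {N : Set E} (hN : N ∈ 𝓝 p) (hsmall : ∀ η > 0, ∀ᶠ t in atTop, x t ∈ N → |φ (x t)| ≤ η) :
    ψ p = 0 := by
  wlog hpos : 0 < ψ p generalizing φ ψ
  · by_contra hne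
    have hneg : 0 < -ψ p := by
      have := lt_of_le_of_ne (not_lt.1 hpos) hne
      linarith
    have := this (φ := fun y => -φ y) (ψ := fun y => -ψ y) (fun t ht => (hφ t ht).neg) hφc.neg
      hψ.neg (by simpa using hsmall) hneg
    exact hne (neg_eq_zero.1 this)
  exfalso
  obtain ⟨B, hB⟩ : ∃ B, ‖f p‖ < B := exists_gt _
  have hB0 : 0 < B := (norm_nonneg _).trans_lt hB
  have hnear : ∀ᶠ y in 𝓝 p, y ∈ N ∧ ψ p / 2 < ψ y ∧ ‖f y‖ < B :=
    (eventually_mem_set.2 hN).and ((hψ.eventually_const_lt (half_lt_self hpos)).and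
      (hf.norm.eventually_lt_const hB))
  obtain ⟨ρ, hρ, hball⟩ := Metric.nhds_basis_closedBall.eventually_iff.1 hnear
  -- At speed below `B`, a trajectory starting within `ρ / 2` of `p` needs at least time `τ` to
  -- leave the `ρ`-ball.
  set τ : ℝ := ρ / 2 / B with hτ
  have hτ0 : 0 < τ := by positivity
  -- During time `τ` near `p`, `φ` grows by at least `ψ p / 2 * τ`. The bound at both ends allows a
  -- change of only half that amount.
  have hev := (hsmall (ψ p / 2 * τ / 4) (by positivity)).and (eventually_ge_atTop a)
  obtain ⟨T, hT⟩ := eventually_atTop.1 hev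
  obtain ⟨t, hclose, htT⟩ := ((hp.frequently (Metric.ball_mem_nhds p (half_pos hρ))).and_eventually
    (eventually_ge_atTop T)).exists
  have hta : a ≤ t := (hT t htT).2
  have hcont : ContinuousOn x (Icc t (t + τ)) := hxc.mono fun s hs => hta.trans hs.1
  have hstay : ∀ s ∈ Icc t (t + τ), x s ∈ Metric.closedBall p ρ := by
    have hin : ∀ s, ‖x s - x t‖ ≤ B * (s - t) → s ≤ t + τ → x s ∈ Metric.closedBall p ρ := by
      intro s hs hsτ
      have h1 : B * (s - t) ≤ ρ / 2 := by
        calc B * (s - t) ≤ B * τ := by gcongr; linarith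
          _ = ρ / 2 := by rw [hτ]; field_simp
      have h2 := dist_triangle (x s) (x t) p
      rw [dist_eq_norm (x s) (x t)] at h2
      have h3 : dist (x t) p < ρ / 2 := hclose
      rw [Metric.mem_closedBall]
      linarith
    intro s hs
    refine hin s ?_ hs.2
    -- The speed bound is known only inside the ball. The comparison needs it only at times where
    -- `‖x s - x t‖ = B * (s - t)`, and by `hin` the curve is still in the ball then.
    refine image_norm_le_of_norm_deriv_right_lt_deriv_boundary (f := fun s => x s - x t)
      (f' := fun s => f (x s)) (B := fun s => B * (s - t)) (B' := fun _ => B)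
      (hcont.sub continuousOn_const)
      (fun s hs => (hx s (hta.trans hs.1)).sub_const _) (by simp)
      (fun s => by simpa using ((hasDerivAt_id s).sub_const t).const_mul B)
      (fun s hs heq => (hball (hin s heq.le hs.2.le)).2.2) hs
  have hgrow : φ (x t) + ψ p / 2 * τ ≤ φ (x (t + τ)) := by
    have := image_le_of_deriv_right_le_deriv_boundary
      (f := fun s => φ (x t) + ψ p / 2 * (s - t)) (f' := fun _ => ψ p / 2)
      (B := fun s => φ (x s)) (B' := fun s => ψ (x s)) (a := t) (b := t + τ)
      (by fun_prop)
      (fun s _ => by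
        simpa using ((((hasDerivAt_id s).sub_const t).const_mul (ψ p / 2)).const_add
          (φ (x t))).hasDerivWithinAt)
      (by simp) (hφc.comp_continuousOn hcont) (fun s hs => hφ s (hta.trans hs.1))
      (fun s hs => (hball (hstay s (Ico_subset_Icc_self hs))).2.1.le)
      (show t + τ ∈ Icc t (t + τ) from ⟨by linarith, le_rfl⟩)
    simpa using this
  have e1 := (hT t htT).1 (hball (hstay t ⟨le_rfl, by linarith⟩)).1
  have e2 := (hT (t + τ) (by linarith)).1 (hball (hstay (t + τ) ⟨by linarith, le_rfl⟩)).1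
  rw [abs_le] at e1 e2
  have : 0 < ψ p / 2 * τ := by positivity
  linarith

end AutonomousODE

/-! ### Trajectories under singular damping -/

section SingularDamping

variable {E : Type*} [NormedAddCommGroup E] [NormedSpace ℝ E]
  {f : E → E} {H : E → ℝ} {c : E →L[ℝ] ℝ} {k : ℝ} {a b : ℝ} {x : ℝ → E}

theorem energy_le (hH : Differentiable ℝ H) (hk : 0 < k)
    (hdiss : ∀ y, c y ≠ 0 → fderiv ℝ H y (f y) ≤ -k * (c (f y) / c y) ^ 2)
    (hx : ContinuousOn x (Icc a b)) (hc : ∀ t ∈ Ico a b, c (x t) ≠ 0)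
    (hx' : ∀ t ∈ Ico a b, HasDerivWithinAt x (f (x t)) (Ici t) t) :
    ∀ t ∈ Icc a b, H (x t) ≤ H (x a) := by
  refine image_le_of_deriv_right_le_deriv_boundary (f := fun t => H (x t))
    (f' := fun t => fderiv ℝ H (x t) (f (x t))) (B := fun _ => H (x a)) (B' := fun _ => 0)
    (hH.continuous.comp_continuousOn hx)
    (fun t ht => (hH (x t)).hasFDerivAt.comp_hasDerivWithinAt t (hx' t ht)) le_rfl
    continuousOn_const (fun t _ => hasDerivWithinAt_const _ _ _) (fun t ht => ?_)
  refine (hdiss _ (hc t ht)).trans ?_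
  rw [neg_mul]
  exact neg_nonpos.2 (by positivity)

/-- The singular damping bounds the logarithmic derivative of `c` in mean square by the energy, so
`c` decays at most exponentially. -/
theorem exp_mul_abs_le_abs (hH : Differentiable ℝ H) (hH0 : ∀ y, 0 ≤ H y) (hk : 0 < k)
    (hdiss : ∀ y, c y ≠ 0 → fderiv ℝ H y (f y) ≤ -k * (c (f y) / c y) ^ 2)
    (hx : ContinuousOn x (Icc a b)) (hc : ∀ t ∈ Ico a b, c (x t) ≠ 0)
    (hx' : ∀ t ∈ Ico a b, HasDerivWithinAt x (f (x t)) (Ici t) t) :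
    ∀ t ∈ Icc a b,
      Real.exp (-(H (x a) / (2 * k)) - (t - a) / 2) * |c (x a)| ≤ |c (x t)| := by
  have hIco : ∀ t ∈ Ico a b,
      Real.exp (-(H (x a) / (2 * k)) - (t - a) / 2) * |c (x a)| ≤ |c (x t)| := by
    intro t ht
    have hsub : Icc a t ⊆ Ico a b := fun s hs => ⟨hs.1, hs.2.trans_lt ht.2⟩
    have hxt : ContinuousOn x (Icc a t) := hx.mono (hsub.trans Ico_subset_Icc_self)
    -- With `v` the logarithmic derivative of `c`, dissipation bounds the derivative of `log |c| - H
    -- / (2k)` below by `v + v² / 2 ≥ -1/2`. `Real.log` ignores the sign of its argument, so neither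
    -- sign of `c` needs separate treatment.
    have hd : ∀ s ∈ Ico a t, HasDerivWithinAt
        (fun s => Real.log (c (x s)) - H (x s) / (2 * k))
        (c (f (x s)) / c (x s) - fderiv ℝ H (x s) (f (x s)) / (2 * k)) (Ici s) s := by
      intro s hs
      have hs' := hsub (Ico_subset_Icc_self hs)
      have h1 := (c.hasFDerivAt.comp_hasDerivWithinAt s (hx' s hs')).log (hc s hs')
      have h2 := (hH (x s)).hasFDerivAt.comp_hasDerivWithinAt s (hx' s hs')
      exact h1.sub (h2.div_const (2 * k))
    have hmono := image_le_of_deriv_right_le_deriv_boundary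
      (f := fun s => Real.log (c (x a)) - H (x a) / (2 * k) + (-(1 / 2)) * (s - a))
      (f' := fun _ => -(1 / 2))
      (B := fun s => Real.log (c (x s)) - H (x s) / (2 * k))
      (B' := fun s => c (f (x s)) / c (x s) - fderiv ℝ H (x s) (f (x s)) / (2 * k))
      (a := a) (b := t) (by fun_prop)
      (fun s _ => by
        have h := (((hasDerivAt_id s).sub_const a).const_mul (-(1 / 2) : ℝ)).const_add
          (Real.log (c (x a)) - H (x a) / (2 * k))
        rw [mul_one] at h
        exact h.hasDerivWithinAt)
      (by simp)
      (((c.continuous.comp_continuousOn hxt).log fun s hs => hc s (hsub hs)).sub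
        ((hH.continuous.comp_continuousOn hxt).div_const _))
      hd
      (fun s hs => by
        have h := hdiss _ (hc s (hsub (Ico_subset_Icc_self hs)))
        set v := c (f (x s)) / c (x s)
        have h' : fderiv ℝ H (x s) (f (x s)) / (2 * k) ≤ -(v ^ 2 / 2) := by
          rw [div_le_iff₀ (by positivity)]
          linarith
        nlinarith [sq_nonneg (v + 1)])
      (show t ∈ Icc a t from ⟨ht.1, le_rfl⟩)
    have h0 : 0 ≤ H (x t) / (2 * k) := div_nonneg (hH0 _) (by positivity)
    have hlog : -(H (x a) / (2 * k)) - (t - a) / 2 + Real.log |c (x a)| ≤ Real.log |c (x t)| := by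
      rw [Real.log_abs, Real.log_abs]
      linarith
    have hca : c (x a) ≠ 0 := hc a (hsub ⟨le_rfl, ht.1⟩)
    rw [← Real.exp_log (abs_pos.2 hca), ← Real.exp_log (abs_pos.2 (hc t ht)), ← Real.exp_add]
    simpa using Real.exp_le_exp.2 hlog
  intro t ht
  -- At the right endpoint `c` is not yet known to be nonzero, so the logarithm is unavailable and
  -- the bound passes to the limit by continuity.
  rcases eq_or_lt_of_le ht.2 with rfl | hlt
  · rcases eq_or_lt_of_le ht.1 with rfl | hat
    · have h0 : 0 ≤ H (x a) / (2 * k) := div_nonneg (hH0 _) (by positivity)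
      have : Real.exp (-(H (x a) / (2 * k)) - (a - a) / 2) ≤ 1 :=
        Real.exp_le_one_iff.2 (by linarith)
      nlinarith [abs_nonneg (c (x a))]
    · have hcl : t ∈ closure (Ico a t) := by
        rw [closure_Ico hat.ne]
        exact ht
      refine ContinuousWithinAt.closure_le hcl ?_ ?_ hIco
      · exact Continuous.continuousWithinAt (by fun_prop)
      · exact ((c.continuous.comp_continuousOn hx).abs t ht).mono Ico_subset_Icc_self
  · exact hIco t ⟨ht.1, hlt⟩

/-- A trajectory with singular damping never reaches the singular set. -/
theorem ne_zero_of_singular_damping (hH : Differentiable ℝ H) (hH0 : ∀ y, 0 ≤ H y) (hk : 0 < k)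
    (hdiss : ∀ y, c y ≠ 0 → fderiv ℝ H y (f y) ≤ -k * (c (f y) / c y) ^ 2)
    (hx : ContinuousOn x (Icc a b)) (hca : c (x a) ≠ 0)
    (hx' : ∀ t ∈ Ico a b, c (x t) ≠ 0 → HasDerivWithinAt x (f (x t)) (Ici t) t) :
    ∀ t ∈ Icc a b, c (x t) ≠ 0 := by
  by_contra! hne
  have hcpt : IsCompact (Icc a b ∩ (fun t => c (x t)) ⁻¹' {0}) :=
    isCompact_Icc.of_isClosed_subset
      ((c.continuous.comp_continuousOn hx).preimage_isClosed_of_isClosed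
      isClosed_Icc isClosed_singleton) inter_subset_left
  obtain ⟨s, ⟨hs, hs0⟩, hleast⟩ := hcpt.exists_isLeast (by
    obtain ⟨t, ht, h⟩ := hne
    exact ⟨t, ht, h⟩)
  have hbefore : ∀ t ∈ Ico a s, c (x t) ≠ 0 := fun t ht h =>
    (hleast ⟨⟨ht.1, ht.2.le.trans hs.2⟩, h⟩).not_gt ht.2
  have := exp_mul_abs_le_abs hH hH0 hk hdiss (hx.mono (Icc_subset_Icc_right hs.2)) hbefore
    (fun t ht => hx' t ⟨ht.1, ht.2.trans_le hs.2⟩ (hbefore t ht)) s ⟨hs.1, le_rfl⟩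
  rw [show c (x s) = 0 from hs0, abs_zero] at this
  exact this.not_gt (mul_pos (Real.exp_pos _) (abs_pos.2 hca))

/-- Energy decay and the exponential lower bound on `|c|` confine every trajectory up to time `b` to
a compact set off the singularity. The constant `ε` is the lower bound at time `b`, the weakest one
on the interval. -/
theorem exists_solution_of_singular_damping [FiniteDimensional ℝ E]
    (hH : Differentiable ℝ H) (hH0 : ∀ y, 0 ≤ H y) (hk : 0 < k)
    (hdiss : ∀ y, c y ≠ 0 → fderiv ℝ H y (f y) ≤ -k * (c (f y) / c y) ^ 2)
    (hf : ContDiffOn ℝ 1 f {y | c y ≠ 0}) (hcpt : ∀ h, IsCompact {y | H y ≤ h})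
    {x₀ : E} (hx₀ : c x₀ ≠ 0) :
    ∃ x : ℝ → E, x a = x₀ ∧ (∀ t ∈ Ici a, c (x t) ≠ 0) ∧
      ∀ t ∈ Ici a, HasDerivWithinAt x (f (x t)) (Ici a) t := by
  refine exists_solution_Ici_of_apriori (U := {y | c y ≠ 0})
    (isOpen_ne_fun c.continuous continuous_const) hf fun b hb => ?_
  set ε := Real.exp (-(H x₀ / (2 * k)) - (b - a) / 2) * |c x₀| with hε
  have hε0 : 0 < ε := mul_pos (Real.exp_pos _) (abs_pos.2 hx₀)
  refine ⟨{y | H y ≤ H x₀} ∩ {y | ε ≤ |c y|},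
    (hcpt _).inter_right (isClosed_le continuous_const c.continuous.abs),
    fun y hy => abs_pos.1 (hε0.trans_le hy.2), ?_⟩
  intro s hs x hxa hx hxU hx' t ht
  subst hxa
  refine ⟨energy_le hH hk hdiss hx hxU hx' t ht,
    le_trans ?_ (exp_mul_abs_le_abs hH hH0 hk hdiss hx hxU hx' t ht)⟩
  rw [hε]
  gcongr
  exact ht.2.trans hs

/-- A trajectory with singular damping converges to the singular set, provided that the closed loop
has no equilibrium off this set. -/
theorem tendsto_zero_of_singular_damping {ι : Type*} [Fintype ι] {π : E →L[ℝ] (ι → ℝ)}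
    (hH : ContDiff ℝ 1 H) (hH0 : ∀ y, 0 ≤ H y) (hk : 0 < k)
    (hdiss : ∀ y, c y ≠ 0 → fderiv ℝ H y (f y) ≤ -k * (c (f y) / c y) ^ 2)
    (hf : ContinuousOn f {y | c y ≠ 0}) (hcpt : ∀ h, IsCompact {y | H y ≤ h})
    (hstrict : ∀ y, c y ≠ 0 → fderiv ℝ H y (f y) = 0 → π y = 0)
    (hno : ∀ y, c y ≠ 0 → π y = 0 → π (f y) ≠ 0)
    (hxc : ContinuousOn x (Ici a)) (hc : ∀ t ≥ a, c (x t) ≠ 0)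
    (hx : ∀ t ≥ a, HasDerivWithinAt x (f (x t)) (Ici t) t) :
    Tendsto (fun t => c (x t)) atTop (𝓝 0) := by
  have hHd : Differentiable ℝ H := hH.differentiable (by simp)
  have hU : IsOpen {y | c y ≠ 0} := isOpen_ne_fun c.continuous continuous_const
  have hmono : ∀ s t, a ≤ s → s ≤ t → H (x t) ≤ H (x s) := fun s t has hst =>
    energy_le hHd hk hdiss (hxc.mono fun u hu => has.trans hu.1)
      (fun u hu => hc u (has.trans hu.1)) (fun u hu => hx u (has.trans hu.1)) t ⟨hst, le_rfl⟩
  obtain ⟨h, hh⟩ : ∃ h, Tendsto (fun t => H (x t)) atTop (𝓝 h) := by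
    have hanti : Antitone fun t => H (x (max t a)) := fun s t hst =>
      hmono _ _ (le_max_right _ _) (max_le_max_right a hst)
    refine ⟨_, (tendsto_atTop_ciInf hanti ⟨0, ?_⟩).congr' ?_⟩
    · rintro _ ⟨t, rfl⟩
      exact hH0 _
    · filter_upwards [eventually_ge_atTop a] with t ht
      simp [max_eq_left ht]
  -- The rate lemma is applied to the excess energy `H - h`, which tends to zero along the whole
  -- trajectory.
  have hcluster : ∀ y, c y ≠ 0 → MapClusterPt y atTop x → π y = 0 := by
    intro y hy hyx
    have hfy := hf.continuousAt (hU.mem_nhds hy)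
    refine hstrict y hy (rate_eq_zero_of_mapClusterPt (φ := fun y => H y - h)
      (ψ := fun y => fderiv ℝ H y (f y)) hx hxc
      (fun t ht => ((hHd (x t)).hasFDerivAt.comp_hasDerivWithinAt t (hx t ht)).sub_const h)
      (hH.continuous.sub continuous_const) hfy
      ((hH.continuous_fderiv (by simp)).continuousAt.clm_apply hfy) hyx univ_mem fun η hη => ?_)
    filter_upwards [(tendsto_order.1 (tendsto_iff_dist_tendsto_zero.1 hh)).2 η hη] with t ht _
    exact ht.le
  by_contra hnot
  obtain ⟨ε, hε, hfreq⟩ : ∃ ε > 0, ∃ᶠ t in atTop, ε ≤ |c (x t)| := by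
    rw [Metric.tendsto_nhds] at hnot
    push Not at hnot
    obtain ⟨ε, hε, h⟩ := hnot
    exact ⟨ε, hε, h.mono fun t ht => by simpa using ht⟩
  have hsub : ∀ᶠ t in atTop, x t ∈ {y | H y ≤ H (x a)} := by
    filter_upwards [eventually_ge_atTop a] with t ht using hmono a t le_rfl ht
  obtain ⟨y, ⟨-, hyε⟩, hyx⟩ :=
    ((hcpt (H (x a))).inter_right (isClosed_le continuous_const c.continuous.abs :
      IsClosed {y | ε ≤ |c y|})).exists_mapClusterPt_of_frequently
      ((hfreq.and_eventually hsub).mono fun t ht => ⟨ht.2, ht.1⟩)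
  have hy : c y ≠ 0 := abs_pos.1 (hε.trans_le hyε)
  have hfy := hf.continuousAt (hU.mem_nhds hy)
  refine hno y hy (hcluster y hy hyx) (funext fun i => ?_)
  have hN : {z | ε / 2 ≤ |c z|} ∈ 𝓝 y :=
    mem_of_superset ((isOpen_lt continuous_const c.continuous.abs).mem_nhds
      (show ε / 2 < |c y| from (half_lt_self hε).trans_le hyε)) fun z (hz : ε / 2 < |c z|) =>
        show ε / 2 ≤ |c z| from hz.le
  have hπi : Continuous fun z => π z i := (continuous_apply i).comp π.continuous
  refine rate_eq_zero_of_mapClusterPt (φ := fun z => π z i) (ψ := fun z => π (f z) i) hx hxc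
    (fun t ht => ?_) hπi hfy (hπi.continuousAt.comp hfy) hyx hN fun η hη => ?_
  · exact hasDerivWithinAt_pi.1 (π.hasFDerivAt.comp_hasDerivWithinAt t (hx t ht)) i
  -- If `π` were not eventually small where `|c| ≥ ε / 2`, compactness would give a cluster point
  -- off the singular set with `π ≠ 0`, against `hcluster`.
  · by_contra hbad
    have hbad' : ∃ᶠ t in atTop, ε / 2 ≤ |c (x t)| ∧ η ≤ |π (x t) i| :=
      (not_eventually.1 hbad).mono fun t ht => by
        push Not at ht
        exact ⟨ht.1, ht.2.le⟩
    obtain ⟨z, ⟨⟨-, hz1⟩, hz2⟩, hzx⟩ :=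
      (((hcpt (H (x a))).inter_right (isClosed_le continuous_const c.continuous.abs :
        IsClosed {y | ε / 2 ≤ |c y|})).inter_right (isClosed_le continuous_const hπi.abs :
        IsClosed {y | η ≤ |π y i|})).exists_mapClusterPt_of_frequently
        ((hbad'.and_eventually hsub).mono fun t ht => ⟨⟨ht.2, ht.1.1⟩, ht.1.2⟩)
    have hz := hcluster z (abs_pos.1 ((half_pos hε).trans_le hz1)) hzx
    have : η ≤ |π z i| := hz2
    rw [hz] at this
    simp at this
    linarith

end SingularDamping

/-! ### Nonsingularity of a Hankel matrix of inverse factorials -/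

section InverseFactorialHankel

open Polynomial

/-- The sums are the values at `1` of the derivatives of orders `0, …, r - 1` of `P = ∑ uₐ X^(a+r+1)
/ (a+r+1)!`, with `b = r - 1 - m` for order `m`. If they vanish, then `(X - 1)^r` divides `P`, and
so does the coprime `X^(r+1)`. The product has degree `2r + 1`, whereas `P` has degree at most `2r`,
so `P = 0`. -/
theorem eq_zero_of_sum_div_factorial_eq_zero {r : ℕ} (u : Fin r → ℝ)
    (h : ∀ b : Fin r, ∑ a : Fin r, u a / (Nat.factorial ((a : ℕ) + b + 2) : ℝ) = 0) : u = 0 := by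
  let P : ℝ[X] := ∑ a : Fin r,
    C (u a / (Nat.factorial ((a : ℕ) + r + 1) : ℝ)) * X ^ ((a : ℕ) + r + 1)
  have hcoeff : ∀ a : Fin r, P.coeff ((a : ℕ) + r + 1) =
      u a / (Nat.factorial ((a : ℕ) + r + 1) : ℝ) := fun a => by
    simp only [P, finsetSum_coeff, coeff_C_mul_X_pow]
    rw [Finset.sum_eq_single a]
    · simp
    · intro b _ hb
      rw [if_neg]
      intro h
      exact hb (Fin.ext (by omega))
    · simp
  suffices hP : P = 0 by
    funext a
    have := hcoeff a
    rw [hP, coeff_zero, eq_comm, div_eq_zero_iff] at this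
    exact this.resolve_right (by positivity)
  by_contra hP
  have hdeg : P.natDegree ≤ 2 * r := natDegree_sum_le_of_forall_le _ _ fun a _ =>
    (natDegree_C_mul_X_pow_le _ _).trans (by omega)
  have hX : X ^ (r + 1) ∣ P := Finset.dvd_sum fun a _ =>
    Dvd.dvd.mul_left (pow_dvd_pow X (by omega)) _
  have hroot : ∀ m < r, (derivative^[m] P).IsRoot 1 := by
    intro m hm
    have hb := h ⟨r - 1 - m, by omega⟩
    rw [IsRoot.def, ← hb, iterate_derivative_sum, eval_finsetSum]
    refine Finset.sum_congr rfl fun a _ => ?_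
    rw [iterate_derivative_C_mul, iterate_derivative_X_pow_eq_natCast_mul]
    simp only [eval_mul, eval_C, eval_natCast, eval_pow, eval_X, one_pow, mul_one]
    have hle : m ≤ (a : ℕ) + r + 1 := by omega
    have hfac := Nat.factorial_mul_descFactorial hle
    have hidx : (a : ℕ) + (r - 1 - m) + 2 = (a : ℕ) + r + 1 - m := by omega
    rw [hidx, ← hfac]
    push_cast
    have h1 : ((Nat.factorial ((a : ℕ) + r + 1 - m) : ℕ) : ℝ) ≠ 0 := by positivity
    have h2 : ((Nat.descFactorial ((a : ℕ) + r + 1) m : ℕ) : ℝ) ≠ 0 := by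
      have := Nat.descFactorial_pos.2 hle
      positivity
    field_simp
  have h1 : (X - C (1 : ℝ)) ^ r ∣ P := by
    rcases Nat.eq_zero_or_pos r with rfl | hr
    · simp
    · have := (lt_rootMultiplicity_iff_isRoot_iterate_derivative hP (t := 1) (n := r - 1)).2
        fun m hm => hroot m (by omega)
      exact (le_rootMultiplicity_iff hP).1 (by omega)
  have hcop : IsCoprime ((X : ℝ[X]) ^ (r + 1)) ((X - C (1 : ℝ)) ^ r) :=
    IsCoprime.pow ⟨1, -1, by simp⟩
  have hdvd := natDegree_le_of_dvd (hcop.mul_dvd hX h1) hP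
  rw [natDegree_mul (by simp) (pow_ne_zero _ (X_sub_C_ne_zero 1)), natDegree_X_pow, natDegree_pow,
    natDegree_X_sub_C] at hdvd
  omega

end InverseFactorialHankel

/-! ### Smoothness of determinants and inverse matrices -/

section MatrixInverse

variable {E : Type*} [NormedAddCommGroup E] [NormedSpace ℝ E] {m : Type*} [Fintype m]
  [DecidableEq m] {n : WithTop ℕ∞} {A : E → Matrix m m ℝ} {x : E}

theorem contDiffAt_matrix_det (hA : ∀ i j, ContDiffAt ℝ n (fun y => A y i j) x) :
    ContDiffAt ℝ n (fun y => (A y).det) x := by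
  simp only [Matrix.det_apply']
  exact ContDiffAt.sum fun σ _ => contDiffAt_const.mul (contDiffAt_prod fun i _ => hA _ _)

theorem contDiffAt_matrix_inv (hA : ∀ i j, ContDiffAt ℝ n (fun y => A y i j) x)
    (hdet : (A x).det ≠ 0) (i j : m) : ContDiffAt ℝ n (fun y => (A y)⁻¹ i j) x := by
  simp only [Matrix.inv_def, Ring.inverse_eq_inv', Matrix.smul_apply, smul_eq_mul,
    Matrix.adjugate_apply]
  refine ((contDiffAt_matrix_det hA).inv hdet).mul (contDiffAt_matrix_det fun a b => ?_)
  by_cases h : a = j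
  · subst h
    simpa using contDiffAt_const
  · simpa [Matrix.updateRow_ne h] using hA a b

end MatrixInverse

/-! ### The discontinuous coordinate transformation -/

section DiscontinuousTransformation

variable {r : ℕ}

/-- The matrix `A(x)` with `fwInv w = A(w₁) w`. -/
noncomputable def fwMatrix (r : ℕ) (x : ℝ) : Matrix (Fin (r + 2)) (Fin (r + 2)) ℝ :=
  Matrix.of fun j c =>
    if j = 0 then (if c = 0 then 1 else 0)
    else if j = 1 then
      (Fin.cases 0 (Fin.cases x fun i =>
        1 / (Nat.factorial ((i : ℕ) + 1) : ℝ) * x ^ ((i : ℕ) + 1)) c)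
    else
      (Fin.cases 0 (Fin.cases 0 fun i =>
        1 / (Nat.factorial ((i : ℕ) + (j : ℕ)) : ℝ) * x ^ ((i : ℕ) + (j : ℕ))) c)

theorem fwMatrix_mulVec (x : ℝ) (w : Fin (r + 2) → ℝ) (j : Fin (r + 2)) :
    (fwMatrix r x *ᵥ w) j = if j = 0 then w 0
      else if j = 1 then x * w 1 + ∑ i : Fin r,
        1 / (Nat.factorial ((i : ℕ) + 1) : ℝ) * x ^ ((i : ℕ) + 1) * w i.succ.succ
      else ∑ i : Fin r,
        1 / (Nat.factorial ((i : ℕ) + (j : ℕ)) : ℝ) * x ^ ((i : ℕ) + (j : ℕ)) * w i.succ.succ := by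
  simp only [Matrix.mulVec, dotProduct, fwMatrix, Matrix.of_apply]
  split_ifs with h0 h1
  · simp
  · simp [Fin.sum_univ_succ]
  · simp [Fin.sum_univ_succ]

theorem fwInv_eq_fwMatrix_mulVec (w : Fin (r + 2) → ℝ) : fwInv w = fwMatrix r (w 0) *ᵥ w := by
  funext j
  rw [fwMatrix_mulVec]
  rfl

theorem fwInv_zero (w : Fin (r + 2) → ℝ) : fwInv w 0 = w 0 := by simp [fwInv]

/-- The lower right block of `A(x)` is nonsingular for `x ≠ 0`. -/
theorem eq_zero_of_sum_pow_div_factorial_eq_zero {x : ℝ} (hx : x ≠ 0) {u : Fin r → ℝ}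
    (h : ∀ b : Fin r, ∑ i : Fin r, 1 / (Nat.factorial ((i : ℕ) + (b.succ.succ : Fin (r + 2))) : ℝ) *
      x ^ ((i : ℕ) + (b.succ.succ : Fin (r + 2))) * u i = 0) : u = 0 := by
  -- Splitting `x ^ (i + b + 2)` as `x ^ (b + 2) * x ^ i` scales rows and columns, which reduces the
  -- block to the Hankel matrix.
  have hz := eq_zero_of_sum_div_factorial_eq_zero (fun i => x ^ (i : ℕ) * u i) fun b => by
    have hb := h b
    have : ∑ i : Fin r, 1 / (Nat.factorial ((i : ℕ) + (b.succ.succ : Fin (r + 2))) : ℝ) *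
        x ^ ((i : ℕ) + (b.succ.succ : Fin (r + 2))) * u i =
        x ^ ((b : ℕ) + 2) *
          ∑ a : Fin r, x ^ (a : ℕ) * u a / (Nat.factorial ((a : ℕ) + b + 2) : ℝ) := by
      rw [Finset.mul_sum]
      refine Finset.sum_congr rfl fun i _ => ?_
      have e : (i : ℕ) + (b.succ.succ : Fin (r + 2)) = (i : ℕ) + b + 2 := by simp; ring
      rw [e]
      ring
    rw [this, mul_eq_zero] at hb
    exact hb.resolve_left (pow_ne_zero _ hx)
  funext i
  have := congrFun hz i
  exact (mul_eq_zero.1 this).resolve_left (pow_ne_zero _ hx)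

theorem fwMatrix_det_ne_zero {x : ℝ} (hx : x ≠ 0) : (fwMatrix r x).det ≠ 0 := by
  rw [← isUnit_iff_ne_zero, ← Matrix.isUnit_iff_isUnit_det, ← Matrix.mulVec_injective_iff_isUnit,
    ← Matrix.coe_mulVecLin, ← LinearMap.ker_eq_bot, LinearMap.ker_eq_bot']
  intro w hw
  have hw' : ∀ j, (fwMatrix r x *ᵥ w) j = 0 := fun j => congrFun hw j
  have h0 : w 0 = 0 := by simpa [fwMatrix_mulVec] using hw' 0
  have h2 : (fun i : Fin r => w i.succ.succ) = 0 :=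
    eq_zero_of_sum_pow_div_factorial_eq_zero hx fun b => by
      have := hw' b.succ.succ
      rwa [fwMatrix_mulVec, if_neg (Fin.succ_ne_zero _), if_neg] at this
      exact fun h => Fin.succ_ne_zero b (Fin.succ_injective _ h)
  have h2' : ∀ i : Fin r, w i.succ.succ = 0 := fun i => congrFun h2 i
  have h1 : w 1 = 0 := by
    have := hw' 1
    rw [fwMatrix_mulVec, if_neg (by simp), if_pos rfl] at this
    simpa [h2', hx] using this
  funext j
  refine Fin.cases h0 (fun j => Fin.cases h1 (fun j => h2' j) j) j

/-- `fwInv` preserves the first coordinate. With `z` given, `fwInv w = z` is thus a linear system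
for `w` with the fixed matrix `fwMatrix r (z 0)`, which determines the value of `Function.invFun`.
-/
theorem fw_eq {z : Fin (r + 2) → ℝ} (hz : z 0 ≠ 0) : fw z = (fwMatrix r (z 0))⁻¹ *ᵥ z := by
  have hdet : IsUnit (fwMatrix r (z 0)).det := isUnit_iff_ne_zero.2 (fwMatrix_det_ne_zero hz)
  have hcancel : fwMatrix r (z 0) *ᵥ ((fwMatrix r (z 0))⁻¹ *ᵥ z) = z := by
    rw [Matrix.mulVec_mulVec, Matrix.mul_nonsing_inv _ hdet, Matrix.one_mulVec]
  have hex : ∃ w : Fin (r + 2) → ℝ, fwInv w = z := by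
    refine ⟨(fwMatrix r (z 0))⁻¹ *ᵥ z, ?_⟩
    have h0 : ((fwMatrix r (z 0))⁻¹ *ᵥ z) 0 = z 0 := by
      have := congrFun hcancel 0
      rwa [fwMatrix_mulVec, if_pos rfl] at this
    rw [fwInv_eq_fwMatrix_mulVec, h0, hcancel]
  have hinv : fwInv (fw z) = z := Function.invFun_eq hex
  have h0 : fw z 0 = z 0 := by rw [← fwInv_zero (fw z), hinv]
  nth_rw 3 [← hinv]
  rw [fwInv_eq_fwMatrix_mulVec, h0, Matrix.mulVec_mulVec, Matrix.nonsing_inv_mul _ hdet,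
    Matrix.one_mulVec]

theorem fw_fwInv {w : Fin (r + 2) → ℝ} (hw : w 0 ≠ 0) : fw (fwInv w) = w := by
  have h0 : fwInv w 0 ≠ 0 := by rwa [fwInv_zero]
  rw [fw_eq h0, fwInv_zero, fwInv_eq_fwMatrix_mulVec, Matrix.mulVec_mulVec,
    Matrix.nonsing_inv_mul _ (isUnit_iff_ne_zero.2 (fwMatrix_det_ne_zero hw)), Matrix.one_mulVec]

theorem fwInv_fw {z : Fin (r + 2) → ℝ} (hz : z 0 ≠ 0) : fwInv (fw z) = z := by
  have hdet : IsUnit (fwMatrix r (z 0)).det := isUnit_iff_ne_zero.2 (fwMatrix_det_ne_zero hz)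
  have hcancel : fwMatrix r (z 0) *ᵥ fw z = z := by
    rw [fw_eq hz, Matrix.mulVec_mulVec, Matrix.mul_nonsing_inv _ hdet, Matrix.one_mulVec]
  have h0 : fw z 0 = z 0 := by
    have := congrFun hcancel 0
    rwa [fwMatrix_mulVec, if_pos rfl] at this
  rw [fwInv_eq_fwMatrix_mulVec, h0, hcancel]

theorem contDiff_fwInv {n : WithTop ℕ∞} : ContDiff ℝ n (fwInv : (Fin (r + 2) → ℝ) → _) := by
  rw [contDiff_pi]
  intro j
  unfold fwInv
  split_ifs <;> fun_prop

theorem contDiffAt_fwMatrix {n : WithTop ℕ∞} {x : ℝ} (i j : Fin (r + 2)) :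
    ContDiffAt ℝ n (fun y => fwMatrix r y i j) x := by
  simp only [fwMatrix, Matrix.of_apply]
  split_ifs
  · exact contDiffAt_const
  · exact contDiffAt_const
  · refine Fin.cases ?_ (fun j => Fin.cases ?_ (fun j => ?_) j) j <;>
      simp only [Fin.cases_zero, Fin.cases_succ] <;> fun_prop
  · refine Fin.cases ?_ (fun j => Fin.cases ?_ (fun j => ?_) j) j <;>
      simp only [Fin.cases_zero, Fin.cases_succ] <;> fun_prop

theorem contDiffAt_fw {n : WithTop ℕ∞} {z : Fin (r + 2) → ℝ} (hz : z 0 ≠ 0) :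
    ContDiffAt ℝ n fw z := by
  have hev : (fw : (Fin (r + 2) → ℝ) → _) =ᶠ[𝓝 z] fun y => (fwMatrix r (y 0))⁻¹ *ᵥ y :=
    ((isOpen_ne_fun (continuous_apply 0) continuous_const).eventually_mem hz).mono
      fun y hy => fw_eq hy
  refine ContDiffAt.congr_of_eventuallyEq ?_ hev
  rw [contDiffAt_pi]
  intro i
  simp only [Matrix.mulVec, dotProduct]
  refine ContDiffAt.sum fun j _ => ContDiffAt.mul ?_ (by fun_prop)
  refine contDiffAt_matrix_inv (A := fun y : Fin (r + 2) → ℝ => fwMatrix r (y 0)) (fun a b => ?_)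
    (fwMatrix_det_ne_zero hz) i j
  exact (contDiffAt_fwMatrix a b).comp z
    (by fun_prop : ContDiffAt ℝ n (fun y : Fin (r + 2) → ℝ => y 0) z)

theorem jacobian_mulVec {m l : ℕ} (g : (Fin m → ℝ) → (Fin l → ℝ)) (x v : Fin m → ℝ) :
    jacobian g x *ᵥ v = fderiv ℝ g x v := by
  funext i
  conv_rhs => rw [pi_eq_sum_univ' v, map_sum]
  simp [Matrix.mulVec, dotProduct, jacobian, mul_comm]

theorem grad_dotProduct {m : ℕ} (g : (Fin m → ℝ) → ℝ) (x v : Fin m → ℝ) :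
    grad g x ⬝ᵥ v = fderiv ℝ g x v := by
  conv_rhs => rw [pi_eq_sum_univ' v, map_sum]
  simp [dotProduct, grad, mul_comm]

/-- Derivative of `fwInv`, by components. -/
theorem fderiv_fwInv (w ξ : Fin (r + 2) → ℝ) (j : Fin (r + 2)) :
    fderiv ℝ fwInv w ξ j = (fwMatrix r (w 0) *ᵥ ξ) j + ξ 0 * (if j = 0 then 0
      else if j = 1 then w 1 + ∑ i : Fin r,
        1 / (Nat.factorial (i : ℕ) : ℝ) * w 0 ^ (i : ℕ) * w i.succ.succ
      else ∑ i : Fin r, 1 / (Nat.factorial ((i : ℕ) + (j : ℕ) - 1) : ℝ) *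
        w 0 ^ ((i : ℕ) + (j : ℕ) - 1) * w i.succ.succ) := by
  have hline : HasDerivAt (fun s : ℝ => w + s • ξ) ξ 0 := by
    simpa using ((hasDerivAt_id (0 : ℝ)).smul_const ξ).const_add w
  have hcoord : ∀ i, HasDerivAt (fun s : ℝ => (w + s • ξ) i) (ξ i) 0 := hasDerivAt_pi.1 hline
  -- Differentiating `x ^ m / m!` for `m > 0` gives the same expression with `m - 1`; this makes the
  -- `w₁`-derivative of one row resemble the preceding row.
  have hmono : ∀ m : ℕ, 0 < m → ∀ i : Fin r, HasDerivAt
      (fun s : ℝ => 1 / (Nat.factorial m : ℝ) * (w + s • ξ) 0 ^ m * (w + s • ξ) i.succ.succ)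
      (1 / (Nat.factorial m : ℝ) * w 0 ^ m * ξ i.succ.succ +
        ξ 0 * (1 / (Nat.factorial (m - 1) : ℝ) * w 0 ^ (m - 1) * w i.succ.succ)) 0 := by
    intro m hm i
    have h := (((hcoord 0).pow m).const_mul (1 / (Nat.factorial m : ℝ))).mul (hcoord i.succ.succ)
    refine h.congr_deriv ?_
    obtain ⟨k, rfl⟩ : ∃ k, m = k + 1 := ⟨m - 1, by omega⟩
    have hk : (Nat.factorial k : ℝ) ≠ 0 := by positivity
    have hk' : ((k : ℝ) + 1) ≠ 0 := by positivity
    simp only [zero_smul, add_zero, Nat.factorial_succ, Nat.add_sub_cancel, Pi.pow_apply]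
    push_cast
    field_simp
    ring
  have hchain : HasDerivAt (fun s : ℝ => fwInv (w + s • ξ) j) (fderiv ℝ fwInv w ξ j) 0 := by
    have hd : HasFDerivAt fwInv (fderiv ℝ fwInv w) (w + (0 : ℝ) • ξ) := by
      rw [zero_smul, add_zero]
      exact (contDiff_fwInv.differentiable (n := 1) (by simp) w).hasFDerivAt
    exact hasDerivAt_pi.1 (hd.comp_hasDerivAt (0 : ℝ) hline) j
  refine hchain.unique ?_
  rw [fwMatrix_mulVec]
  unfold fwInv
  split_ifs with h0 h1
  · simpa using hcoord 0
  · refine (((hcoord 0).mul (hcoord 1)).add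
      (HasDerivAt.fun_sum fun (i : Fin r) _ => hmono ((i : ℕ) + 1) (by omega) i)).congr_deriv ?_
    simp only [zero_smul, add_zero, Nat.add_sub_cancel, Finset.sum_add_distrib, ← Finset.mul_sum]
    ring
  · have hj : 0 < (j : ℕ) := Nat.pos_of_ne_zero fun h => h0 (Fin.ext h)
    refine (HasDerivAt.fun_sum fun (i : Fin r) _ => hmono ((i : ℕ) + j) (by omega) i).congr_deriv ?_
    simp only [Finset.sum_add_distrib, ← Finset.mul_sum]

/-- With `w₂ = 0`, a curve that obeys the chained constraints moves `w₃, …, wₙ` with zero speed;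
so does, for arbitrary `w₂`, a curve along which `w₁` is stationary. -/
theorem eq_zero_of_fderiv_fwInv_chained {w ξ : Fin (r + 2) → ℝ} (hw : w 0 ≠ 0)
    (h : ∀ j : Fin r, fderiv ℝ fwInv w ξ j.succ.succ = fwInv w j.castSucc.succ * ξ 0)
    (h1 : w 1 * ξ 0 = 0) (i : Fin r) : ξ i.succ.succ = 0 := by
  refine congrFun (eq_zero_of_sum_pow_div_factorial_eq_zero (u := fun i : Fin r => ξ i.succ.succ) hw
    fun b => ?_) i
  have hb := h b
  have hne : (b.succ.succ : Fin (r + 2)) ≠ 1 :=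
    fun h => Fin.succ_ne_zero b (Fin.succ_injective _ h)
  rw [fderiv_fwInv, fwMatrix_mulVec] at hb
  simp only [if_neg (Fin.succ_ne_zero _), if_neg hne] at hb
  -- The `w₁`-derivative of each row is the preceding coordinate of `z`, so it cancels against the
  -- constraint. The exception is `z₃`, whose derivative is `z₂ - w₁ w₂`; the defect is killed by
  -- `h1`. What remains is the nonsingular block applied to `ξ₃, …, ξₙ`.
  have hprev : fwInv w b.castSucc.succ * ξ 0 = ξ 0 * ∑ i : Fin r,
      1 / (Nat.factorial ((i : ℕ) + ((b.succ.succ : Fin (r + 2)) : ℕ) - 1) : ℝ) *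
        w 0 ^ ((i : ℕ) + ((b.succ.succ : Fin (r + 2)) : ℕ) - 1) * w i.succ.succ := by
    unfold fwInv
    rw [if_neg (Fin.succ_ne_zero _)]
    split_ifs with hb1
    · have hb0 : (b : ℕ) = 0 := by
        have := congrArg Fin.val hb1
        simpa using this
      have hidx : ∀ i : Fin r, (i : ℕ) + ((b.succ.succ : Fin (r + 2)) : ℕ) - 1 = i + 1 :=
        fun i => by simp [hb0]
      simp only [hidx]
      linear_combination w 0 * h1
    · have hidx : ∀ i : Fin r, (i : ℕ) + ((b.succ.succ : Fin (r + 2)) : ℕ) - 1 =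
          (i : ℕ) + ((b.castSucc.succ : Fin (r + 2)) : ℕ) := fun i => by simp
      simp only [hidx]
      ring
  linear_combination hb + hprev

end DiscontinuousTransformation

/-! ### Matrix calculus, gradients and quadratic forms -/

section MatrixCalculus

variable {E : Type*} [NormedAddCommGroup E] [NormedSpace ℝ E] {a b c : Type*} [Fintype b]
  {n : WithTop ℕ∞} {x : E}

theorem contDiffAt_matrix_mul {A : E → Matrix a b ℝ} {B : E → Matrix b c ℝ}
    (hA : ∀ i j, ContDiffAt ℝ n (fun y => A y i j) x)
    (hB : ∀ i j, ContDiffAt ℝ n (fun y => B y i j) x) (i : a) (j : c) :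
    ContDiffAt ℝ n (fun y => (A y * B y) i j) x := by
  simp only [Matrix.mul_apply]
  exact ContDiffAt.sum fun k _ => (hA i k).mul (hB k j)

theorem contDiffAt_matrix_mulVec {A : E → Matrix a b ℝ} {v : E → b → ℝ}
    (hA : ∀ i j, ContDiffAt ℝ n (fun y => A y i j) x)
    (hv : ∀ i, ContDiffAt ℝ n (fun y => v y i) x) (i : a) :
    ContDiffAt ℝ n (fun y => (A y *ᵥ v y) i) x := by
  simp only [Matrix.mulVec, dotProduct]
  exact ContDiffAt.sum fun k _ => (hA i k).mul (hv k)

theorem contDiffAt_dotProduct {u v : E → b → ℝ}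
    (hu : ∀ i, ContDiffAt ℝ n (fun y => u y i) x)
    (hv : ∀ i, ContDiffAt ℝ n (fun y => v y i) x) :
    ContDiffAt ℝ n (fun y => u y ⬝ᵥ v y) x := by
  simp only [dotProduct]
  exact ContDiffAt.sum fun k _ => (hu k).mul (hv k)

/-- Joint smoothness of a Jacobian with respect to a parameter and the base point. -/
theorem contDiffAt_jacobian {m l : ℕ} {g : E → (Fin m → ℝ) → (Fin l → ℝ)} {q : E → (Fin m → ℝ)}
    (hg : ContDiffAt ℝ ∞ (Function.uncurry g) (x, q x)) (hq : ContDiffAt ℝ ∞ q x) (i : Fin l)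
    (j : Fin m) : ContDiffAt ℝ 1 (fun y => jacobian (g y) (q y) i j) x := by
  have h := (ContDiffAt.fderiv hg (hq.of_le (by exact_mod_cast le_top)) (m := 1)
    (WithTop.coe_le_coe.2 (le_top : (1 + 1 : ℕ∞) ≤ ⊤))).clm_apply
    (contDiffAt_const (c := (Pi.single j 1 : Fin m → ℝ)))
  exact contDiffAt_pi.1 h i

theorem contDiffAt_grad {m : ℕ} {g : E → (Fin m → ℝ) → ℝ} {q : E → (Fin m → ℝ)}
    (hg : ContDiffAt ℝ ∞ (Function.uncurry g) (x, q x)) (hq : ContDiffAt ℝ ∞ q x)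
    (j : Fin m) : ContDiffAt ℝ 1 (fun y => grad (g y) (q y) j) x :=
  (ContDiffAt.fderiv hg (hq.of_le (by exact_mod_cast le_top)) (m := 1)
    (WithTop.coe_le_coe.2 (le_top : (1 + 1 : ℕ∞) ≤ ⊤))).clm_apply
    (contDiffAt_const (c := (Pi.single j 1 : Fin m → ℝ)))

theorem contDiff_quadratic {m : ℕ} (A : Matrix (Fin m) (Fin m) ℝ) :
    ContDiff ℝ ∞ fun p : Fin m → ℝ => 1 / 2 * (p ⬝ᵥ (A *ᵥ p)) := by
  simp only [dotProduct, Matrix.mulVec]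
  fun_prop

theorem grad_quadratic {m : ℕ} {A : Matrix (Fin m) (Fin m) ℝ} (hA : Aᵀ = A) (p : Fin m → ℝ) :
    grad (fun p : Fin m → ℝ => 1 / 2 * (p ⬝ᵥ (A *ᵥ p))) p = A *ᵥ p := by
  funext i
  set ξ : Fin m → ℝ := Pi.single i 1 with hξ
  have hsym : p ⬝ᵥ (A *ᵥ ξ) = ξ ⬝ᵥ (A *ᵥ p) := by
    rw [Matrix.dotProduct_mulVec, ← Matrix.mulVec_transpose, hA, dotProduct_comm]
  have hline : HasDerivAt (fun s : ℝ => p + s • ξ) ξ 0 := by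
    simpa using ((hasDerivAt_id (0 : ℝ)).smul_const ξ).const_add p
  have hd : HasFDerivAt (fun p : Fin m → ℝ => 1 / 2 * (p ⬝ᵥ (A *ᵥ p)))
      (fderiv ℝ (fun p : Fin m → ℝ => 1 / 2 * (p ⬝ᵥ (A *ᵥ p))) p) (p + (0 : ℝ) • ξ) := by
    rw [zero_smul, add_zero]
    exact ((contDiff_quadratic A).differentiable (by simp) p).hasFDerivAt
  have h2 : HasDerivAt (fun s : ℝ => 1 / 2 * (p ⬝ᵥ (A *ᵥ p)) + s * (ξ ⬝ᵥ (A *ᵥ p))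
      + s ^ 2 * (1 / 2 * (ξ ⬝ᵥ (A *ᵥ ξ)))) (ξ ⬝ᵥ (A *ᵥ p)) 0 := by
    refine ((((hasDerivAt_id (0 : ℝ)).mul_const (ξ ⬝ᵥ (A *ᵥ p))).const_add
      (1 / 2 * (p ⬝ᵥ (A *ᵥ p)))).add
      ((hasDerivAt_pow 2 (0 : ℝ)).mul_const (1 / 2 * (ξ ⬝ᵥ (A *ᵥ ξ))))).congr_deriv ?_
    simp
  have h1 := hd.comp_hasDerivAt (0 : ℝ) hline
  have heq : ((fun p : Fin m → ℝ => 1 / 2 * (p ⬝ᵥ (A *ᵥ p))) ∘ fun s : ℝ => p + s • ξ) =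
      fun s : ℝ => 1 / 2 * (p ⬝ᵥ (A *ᵥ p)) + s * (ξ ⬝ᵥ (A *ᵥ p))
      + s ^ 2 * (1 / 2 * (ξ ⬝ᵥ (A *ᵥ ξ))) := by
    funext s
    simp only [Function.comp, Matrix.mulVec_add, Matrix.mulVec_smul, dotProduct_add,
      add_dotProduct, smul_dotProduct, dotProduct_smul, smul_eq_mul, hsym]
    ring
  rw [heq] at h1
  have := h1.unique h2
  rw [grad, ← hξ, this, hξ, single_one_dotProduct]

theorem fderiv_uncurry_apply {m l : ℕ} {F : (Fin m → ℝ) → (Fin l → ℝ) → ℝ}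
    (hF : Differentiable ℝ fun x : (Fin m → ℝ) × (Fin l → ℝ) => F x.1 x.2)
    (w a : Fin m → ℝ) (p b : Fin l → ℝ) :
    fderiv ℝ (fun x : (Fin m → ℝ) × (Fin l → ℝ) => F x.1 x.2) (w, p) (a, b) =
      grad (fun w' => F w' p) w ⬝ᵥ a + grad (fun p' => F w p') p ⬝ᵥ b := by
  have h := (hF (w, p)).hasFDerivAt
  have h1 := HasFDerivAt.comp (f := fun w' => (w', p)) w h (hasFDerivAt_prodMk_left (𝕜 := ℝ) w p)
  have h2 := HasFDerivAt.comp (f := fun p' => (w, p')) p h (hasFDerivAt_prodMk_right (𝕜 := ℝ) w p)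
  simp only [Function.comp_def] at h1 h2
  rw [grad_dotProduct, grad_dotProduct, h1.fderiv, h2.fderiv]
  simp [← map_add]

theorem dotProduct_mulVec_eq_zero_of_transpose_eq_neg {m : ℕ} {A : Matrix (Fin m) (Fin m) ℝ}
    (hA : Aᵀ = -A) (v : Fin m → ℝ) : v ⬝ᵥ (A *ᵥ v) = 0 := by
  have h : v ⬝ᵥ (A *ᵥ v) = -(v ⬝ᵥ (A *ᵥ v)) := by
    conv_lhs => rw [Matrix.dotProduct_mulVec, ← Matrix.mulVec_transpose, hA, dotProduct_comm]
    rw [Matrix.neg_mulVec, dotProduct_neg]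
  linarith

theorem mulVec_injective_of_rank_eq {m l : ℕ} {A : Matrix (Fin m) (Fin l) ℝ} (hA : A.rank = l) :
    Function.Injective A.mulVec := by
  have h := A.mulVecLin.finrank_range_add_finrank_ker
  rw [← Matrix.rank, hA, Module.finrank_fin_fun] at h
  rw [← Matrix.coe_mulVecLin, ← LinearMap.ker_eq_bot, ← Submodule.finrank_eq_zero (R := ℝ)]
  omega

/-- This is the Cauchy–Schwarz inequality for the inner product of `A⁻¹`, applied to `p` and `A eᵢ`.
After multiplication by `det A`, the difference of the two sides is a square. -/
theorem sq_le_diag_mul_inv_quadratic {A : Matrix (Fin 2) (Fin 2) ℝ} (hA : A.PosDef)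
    (p : Fin 2 → ℝ) (i : Fin 2) : p i ^ 2 ≤ A i i * (p ⬝ᵥ (A⁻¹ *ᵥ p)) := by
  have hdet := hA.det_pos
  have hsym : A 1 0 = A 0 1 := by simpa using congrFun (congrFun hA.1 0) 1
  have hq : p ⬝ᵥ (A⁻¹ *ᵥ p) =
      (A 1 1 * p 0 ^ 2 - 2 * A 0 1 * p 0 * p 1 + A 0 0 * p 1 ^ 2) / A.det := by
    rw [Matrix.inv_def, Ring.inverse_eq_inv', Matrix.adjugate_fin_two]
    simp [Matrix.mulVec, dotProduct, Fin.sum_univ_two, hsym]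
    field_simp
    ring
  rw [hq, ← mul_div_assoc, le_div_iff₀ hdet, Matrix.det_fin_two, hsym]
  fin_cases i
  · simp only [Fin.zero_eta]
    nlinarith [sq_nonneg (A 0 1 * p 0 - A 0 0 * p 1)]
  · simp only [Fin.mk_one]
    nlinarith [sq_nonneg (A 0 1 * p 1 - A 1 1 * p 0)]

end MatrixCalculus

/-! ### The reduced system: positivity, invertibility of the input matrix, smoothness -/

namespace Coordinates

variable {r : ℕ} {S : NonholonomicSystem r} (R : Coordinates S)

theorem fz_symm_mem (z : Fin (r + 2) → ℝ) : R.fz.symm z ∈ S.Ω := by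
  rw [← R.source_fz]
  exact R.fz.map_target (by rw [R.target_fz]; trivial)

theorem contDiffAt_fz {q : Fin (r + 2) → ℝ} (hq : q ∈ S.Ω) : ContDiffAt ℝ ∞ R.fz q :=
  R.contDiffOn_fz.contDiffAt (S.isOpen_Ω.mem_nhds hq)

theorem Q_mulVec_injective {q : Fin (r + 2) → ℝ} (hq : q ∈ S.Ω) :
    Function.Injective (R.Q q).mulVec :=
  mulVec_injective_of_rank_eq (R.rank_Q q hq)

theorem posDef_M {q : Fin (r + 2) → ℝ} (hq : q ∈ S.Ω) : (R.M q).PosDef := by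
  have h := (S.posDef_M₀ q hq).conjTranspose_mul_mul_same (R.Q_mulVec_injective hq)
  rwa [Matrix.conjTranspose_eq_transpose_of_trivial] at h

theorem posSemidef_D {q : Fin (r + 2) → ℝ} (hq : q ∈ S.Ω) (p : Fin 2 → ℝ) :
    (R.D p q).PosSemidef := by
  have h := (S.posSemidef_D₀ (R.p₀ p q) q hq).conjTranspose_mul_mul_same (R.Q q)
  rwa [Matrix.conjTranspose_eq_transpose_of_trivial] at h

theorem transpose_C (p : Fin 2 → ℝ) (q : Fin (r + 2) → ℝ) : (R.C p q)ᵀ = -R.C p q := by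
  simp only [C, Matrix.transpose_mul, Matrix.transpose_sub, Matrix.transpose_transpose,
    Matrix.mul_sub, Matrix.sub_mul, ← Matrix.mul_assoc, neg_sub]

/-- The reduced input matrix is square and nonsingular. -/
theorem isUnit_det_G {q : Fin (r + 2) → ℝ} (hq : q ∈ S.Ω) : IsUnit (R.G q).det := by
  rw [← Matrix.isUnit_iff_isUnit_det, ← Matrix.isUnit_transpose,
    ← Matrix.mulVec_injective_iff_isUnit, ← Matrix.coe_mulVecLin, ← LinearMap.ker_eq_bot,
    LinearMap.ker_eq_bot']
  intro y hy
  -- For `y` in the kernel of `Gᵀ`, the vector `Q y` is annihilated by both `G₀ᵀ` and `Gcᵀ`, hence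
  -- is zero by the rank condition.
  have hG : (S.G₀ q)ᵀ *ᵥ (R.Q q *ᵥ y) = 0 := by
    rw [Matrix.mulVec_mulVec, ← hy, Matrix.mulVecLin_apply, G, Matrix.transpose_mul,
      Matrix.transpose_transpose]
  have hGc : (S.Gc q)ᵀ *ᵥ (R.Q q *ᵥ y) = 0 := by
    have h := congrArg Matrix.transpose (R.annihilates q hq)
    rw [Matrix.transpose_mul, Matrix.transpose_transpose, Matrix.transpose_zero] at h
    rw [Matrix.mulVec_mulVec, h, Matrix.zero_mulVec]
  have hrank : ((Matrix.fromCols (S.G₀ q) (S.Gc q))ᵀ).rank = r + 2 := by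
    rw [Matrix.rank_transpose, S.rank_G₀_Gc q hq]
  have hker := ((Matrix.fromCols (S.G₀ q) (S.Gc q))ᵀ).mulVecLin.finrank_range_add_finrank_ker
  rw [← Matrix.rank, hrank, Module.finrank_fin_fun] at hker
  have hbot : LinearMap.ker ((Matrix.fromCols (S.G₀ q) (S.Gc q))ᵀ).mulVecLin = ⊥ := by
    rw [← Submodule.finrank_eq_zero (R := ℝ)]
    omega
  have hQy : R.Q q *ᵥ y = 0 := by
    refine LinearMap.ker_eq_bot'.1 hbot _ ?_
    rw [Matrix.mulVecLin_apply, Matrix.transpose_fromCols, Matrix.fromRows_mulVec, hG, hGc]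
    ext (i | i) <;> rfl
  exact R.Q_mulVec_injective hq (by rw [hQy, Matrix.mulVec_zero])

theorem contDiffAt_M {q : Fin (r + 2) → ℝ} (hq : q ∈ S.Ω) (i j : Fin 2) :
    ContDiffAt ℝ ∞ (fun q => R.M q i j) q := by
  have hQ := fun i j => (R.contDiffOn_Q i j).contDiffAt (S.isOpen_Ω.mem_nhds hq)
  have hM := fun i j => (S.contDiffOn_M₀ i j).contDiffAt (S.isOpen_Ω.mem_nhds hq)
  exact contDiffAt_matrix_mul (contDiffAt_matrix_mul (fun i j => hQ j i) hM) hQ i j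

theorem contDiffAt_p₀ {q : Fin (r + 2) → ℝ} (hq : q ∈ S.Ω) (p : Fin 2 → ℝ) :
    ContDiffAt ℝ ∞ (fun x : (Fin 2 → ℝ) × (Fin (r + 2) → ℝ) => R.p₀ x.1 x.2) (p, q) := by
  have hQ := fun i j => (R.contDiffOn_Q i j).contDiffAt (S.isOpen_Ω.mem_nhds hq)
  have hM := fun i j => (S.contDiffOn_M₀ i j).contDiffAt (S.isOpen_Ω.mem_nhds hq)
  have hA : ∀ i j, ContDiffAt ℝ ∞ (fun q => (S.M₀ q * R.Q q * (R.M q)⁻¹) i j) q :=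
    contDiffAt_matrix_mul (contDiffAt_matrix_mul hM hQ)
      (contDiffAt_matrix_inv (R.contDiffAt_M hq) (R.posDef_M hq).det_pos.ne')
  rw [contDiffAt_pi]
  refine contDiffAt_matrix_mulVec (fun i j => ?_) (fun i => by fun_prop)
  exact (hA i j).comp (p, q) contDiffAt_snd

/-- The configuration `q` as a function of `w`. -/
theorem contDiff_config : ContDiff ℝ ∞ fun w : Fin (r + 2) → ℝ => R.fz.symm (fwInv w) :=
  R.contDiff_fz_symm.comp contDiff_fwInv

theorem posDef_Mw (w : Fin (r + 2) → ℝ) : (R.Mw w).PosDef := R.posDef_M (R.fz_symm_mem _)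

theorem contDiff_Mw (i j : Fin 2) : ContDiff ℝ ∞ fun w => R.Mw w i j :=
  contDiff_iff_contDiffAt.2 fun w =>
    ContDiffAt.comp (g := fun q => R.M q i j) (f := fun w => R.fz.symm (fwInv w)) w
      (R.contDiffAt_M (R.fz_symm_mem (fwInv w)) i j) R.contDiff_config.contDiffAt

theorem contDiff_Vw : ContDiff ℝ ∞ R.Vw :=
  contDiff_iff_contDiffAt.2 fun w =>
    ContDiffAt.comp (g := S.V) (f := fun w => R.fz.symm (fwInv w)) w
      (S.contDiffOn_V.contDiffAt (S.isOpen_Ω.mem_nhds (R.fz_symm_mem (fwInv w))))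
      R.contDiff_config.contDiffAt

/-- There is no singularity at `w₁ = 0`: `fwInv` is polynomial and `M_w` is positive definite
everywhere. The results on singular damping need an energy differentiable on the whole space. -/
theorem contDiff_kinetic :
    ContDiff ℝ ∞ fun x : (Fin (r + 2) → ℝ) × (Fin 2 → ℝ) =>
      1 / 2 * (x.2 ⬝ᵥ ((R.Mw x.1)⁻¹ *ᵥ x.2)) := by
  rw [contDiff_iff_contDiffAt]
  intro x
  refine contDiffAt_const.mul (contDiffAt_dotProduct (fun i => by fun_prop)
    (contDiffAt_matrix_mulVec (fun i j => ?_) (fun i => by fun_prop)))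
  refine contDiffAt_matrix_inv (A := fun x : (Fin (r + 2) → ℝ) × (Fin 2 → ℝ) => R.Mw x.1)
    (fun i j => ?_) (R.posDef_Mw x.1).det_pos.ne' i j
  exact (R.contDiff_Mw i j).contDiffAt.comp x contDiffAt_fst

theorem contDiff_Hd (l : Fin (r + 2) → ℝ) :
    ContDiff ℝ ∞ fun x : (Fin (r + 2) → ℝ) × (Fin 2 → ℝ) => R.Hd l x.1 x.2 :=
  R.contDiff_kinetic.add ((contDiff_quadratic (Matrix.diagonal l)).comp contDiff_fst)

/-! ### Gradients of the energies and the matching of open and closed loop -/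

theorem grad_momentum_Hd (l : Fin (r + 2) → ℝ) (w : Fin (r + 2) → ℝ) (p : Fin 2 → ℝ) :
    grad (fun p' => R.Hd l w p') p = (R.Mw w)⁻¹ *ᵥ p := by
  have hsym : ((R.Mw w)⁻¹)ᵀ = (R.Mw w)⁻¹ := by
    simpa [Matrix.conjTranspose_eq_transpose_of_trivial] using (R.posDef_Mw w).inv.1.eq
  rw [← grad_quadratic hsym]
  funext i
  simp only [grad, Hd]
  rw [fderiv_add_const]

theorem grad_momentum_Hw (l : Fin (r + 2) → ℝ) (w : Fin (r + 2) → ℝ) (p : Fin 2 → ℝ) :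
    grad (fun p' => R.Hw w p') p = grad (fun p' => R.Hd l w p') p := by
  funext i
  simp only [grad, Hd, Hw]
  rw [fderiv_add_const, fderiv_add_const]

theorem differentiableAt_kinetic (w : Fin (r + 2) → ℝ) (p : Fin 2 → ℝ) :
    DifferentiableAt ℝ (fun w' => 1 / 2 * (p ⬝ᵥ ((R.Mw w')⁻¹ *ᵥ p))) w :=
  ((R.contDiff_kinetic.comp (contDiff_prodMk_left p)).differentiable (by simp)) w

theorem grad_position_Hd (l : Fin (r + 2) → ℝ) (w : Fin (r + 2) → ℝ) (p : Fin 2 → ℝ) :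
    grad (fun w' => R.Hd l w' p) w =
      grad (fun w' => 1 / 2 * (p ⬝ᵥ ((R.Mw w')⁻¹ *ᵥ p))) w + Matrix.diagonal l *ᵥ w := by
  rw [← grad_quadratic (Matrix.diagonal_transpose l)]
  funext i
  simp only [grad, Hd, Pi.add_apply]
  rw [fderiv_fun_add (R.differentiableAt_kinetic w p)
    ((contDiff_quadratic _).differentiable (by simp) w)]
  rfl

theorem grad_position_Hw (w : Fin (r + 2) → ℝ) (p : Fin 2 → ℝ) :
    grad (fun w' => R.Hw w' p) w =
      grad (fun w' => 1 / 2 * (p ⬝ᵥ ((R.Mw w')⁻¹ *ᵥ p))) w + grad R.Vw w := by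
  funext i
  simp only [grad, Hw, Pi.add_apply]
  rw [fderiv_fun_add (R.differentiableAt_kinetic w p) (R.contDiff_Vw.differentiable (by simp) w)]
  rfl

/-- The control law shapes the potential energy and injects damping. -/
theorem openLoop_controlLaw (l : Fin (r + 2) → ℝ) (Dhat : Matrix (Fin 2) (Fin 2) ℝ) (k : ℝ)
    (w : Fin (r + 2) → ℝ) (p : Fin 2 → ℝ) :
    R.openLoop w p (R.controlLaw l Dhat k w p) = R.closedLoop l Dhat k w p := by
  have hG : IsUnit (R.Gw w).det := R.isUnit_det_G (R.fz_symm_mem _)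
  simp only [openLoop, closedLoop, controlLaw, Prod.mk.injEq, R.grad_momentum_Hw l]
  refine ⟨trivial, ?_⟩
  rw [Matrix.mulVec_neg, Matrix.mulVec_mulVec, Matrix.mul_nonsing_inv _ hG, Matrix.one_mulVec,
    grad_position_Hd, grad_position_Hw, Dd]
  simp only [Matrix.mulVec_add, Matrix.mulVec_sub, Matrix.sub_mulVec, Matrix.add_mulVec]
  abel

/-! ### Regularity of the closed-loop vector field -/

theorem contDiffAt_Qz (z : Fin (r + 2) → ℝ) (i : Fin (r + 2)) (j : Fin 2) :
    ContDiffAt ℝ 1 (fun z => R.Qz z i j) z := by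
  have hq := R.fz_symm_mem z
  refine contDiffAt_matrix_mul (fun i j => ?_) (fun i j => ?_) i j
  · refine contDiffAt_jacobian (g := fun _ => R.fz) (q := R.fz.symm) ?_
      R.contDiff_fz_symm.contDiffAt i j
    exact (R.contDiffAt_fz hq).comp (z, R.fz.symm z) contDiffAt_snd
  · have h := (R.contDiffOn_Q i j).contDiffAt (S.isOpen_Ω.mem_nhds hq)
    exact (h.comp z R.contDiff_fz_symm.contDiffAt).of_le (by exact_mod_cast le_top)

theorem contDiffAt_Qw {w : Fin (r + 2) → ℝ} (hw : w 0 ≠ 0) (i : Fin (r + 2)) (j : Fin 2) :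
    ContDiffAt ℝ 1 (fun w => R.Qw w i j) w := by
  refine contDiffAt_matrix_mul (fun i j => ?_) (fun i j => ?_) i j
  · refine contDiffAt_jacobian (g := fun _ => fw) (q := fwInv) ?_ contDiff_fwInv.contDiffAt i j
    exact (contDiffAt_fw (z := fwInv w) (by rwa [fwInv_zero])).comp (w, fwInv w) contDiffAt_snd
  · exact (R.contDiffAt_Qz (fwInv w) i j).comp w contDiff_fwInv.contDiffAt

theorem contDiffAt_Q_config (w : Fin (r + 2) → ℝ) (i : Fin (r + 2)) (j : Fin 2) :
    ContDiffAt ℝ ∞ (fun w => R.Q (R.fz.symm (fwInv w)) i j) w :=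
  ContDiffAt.comp (g := fun q => R.Q q i j) (f := fun w => R.fz.symm (fwInv w)) w
    ((R.contDiffOn_Q i j).contDiffAt (S.isOpen_Ω.mem_nhds (R.fz_symm_mem (fwInv w))))
    R.contDiff_config.contDiffAt

theorem contDiffAt_Cw (x : (Fin (r + 2) → ℝ) × (Fin 2 → ℝ)) (i j : Fin 2) :
    ContDiffAt ℝ 1 (fun x : (Fin (r + 2) → ℝ) × (Fin 2 → ℝ) => R.Cw x.1 x.2 i j) x := by
  have hQ : ∀ i j, ContDiffAt ℝ 1
      (fun x : (Fin (r + 2) → ℝ) × (Fin 2 → ℝ) => R.Q (R.fz.symm (fwInv x.1)) i j) x :=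
    fun i j => ((R.contDiffAt_Q_config x.1 i j).comp x contDiffAt_fst).of_le
      (by exact_mod_cast le_top)
  have hJ : ∀ i j, ContDiffAt ℝ 1 (fun x : (Fin (r + 2) → ℝ) × (Fin 2 → ℝ) =>
      jacobian (R.p₀ x.2) (R.fz.symm (fwInv x.1)) i j) x := fun i j => by
    refine contDiffAt_jacobian (g := fun x : (Fin (r + 2) → ℝ) × (Fin 2 → ℝ) => R.p₀ x.2)
      (q := fun x => R.fz.symm (fwInv x.1)) ?_ (R.contDiff_config.contDiffAt.comp x contDiffAt_fst)
      i j
    exact (R.contDiffAt_p₀ (R.fz_symm_mem _) x.2).comp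
      (x, R.fz.symm (fwInv x.1)) ((contDiffAt_snd.comp _ contDiffAt_fst).prodMk contDiffAt_snd)
  exact contDiffAt_matrix_mul (contDiffAt_matrix_mul (fun i j => hQ j i)
    fun i j => (hJ j i).sub (hJ i j)) hQ i j

theorem contDiffAt_Dw (x : (Fin (r + 2) → ℝ) × (Fin 2 → ℝ)) (i j : Fin 2) :
    ContDiffAt ℝ 1 (fun x : (Fin (r + 2) → ℝ) × (Fin 2 → ℝ) => R.Dw x.1 x.2 i j) x := by
  have hQ : ∀ i j, ContDiffAt ℝ ∞
      (fun x : (Fin (r + 2) → ℝ) × (Fin 2 → ℝ) => R.Q (R.fz.symm (fwInv x.1)) i j) x :=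
    fun i j => (R.contDiffAt_Q_config x.1 i j).comp x contDiffAt_fst
  have hq := R.fz_symm_mem (fwInv x.1)
  have hconf : ContDiffAt ℝ ∞ (fun x : (Fin (r + 2) → ℝ) × (Fin 2 → ℝ) =>
      R.fz.symm (fwInv x.1)) x := R.contDiff_config.contDiffAt.comp x contDiffAt_fst
  have hp : ContDiffAt ℝ ∞ (fun x : (Fin (r + 2) → ℝ) × (Fin 2 → ℝ) =>
      R.p₀ x.2 (R.fz.symm (fwInv x.1))) x :=
    ContDiffAt.comp (g := fun y : (Fin 2 → ℝ) × (Fin (r + 2) → ℝ) => R.p₀ y.1 y.2)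
      (f := fun x : (Fin (r + 2) → ℝ) × (Fin 2 → ℝ) => (x.2, R.fz.symm (fwInv x.1))) x
      (R.contDiffAt_p₀ hq x.2) (contDiffAt_snd.prodMk hconf)
  have hD : ∀ i j, ContDiffAt ℝ ∞ (fun x : (Fin (r + 2) → ℝ) × (Fin 2 → ℝ) =>
      S.D₀ (R.p₀ x.2 (R.fz.symm (fwInv x.1))) (R.fz.symm (fwInv x.1)) i j) x := fun i j =>
    ContDiffAt.comp (g := fun y : (Fin (r + 2) → ℝ) × (Fin (r + 2) → ℝ) => S.D₀ y.1 y.2 i j)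
      (f := fun x : (Fin (r + 2) → ℝ) × (Fin 2 → ℝ) =>
        (R.p₀ x.2 (R.fz.symm (fwInv x.1)), R.fz.symm (fwInv x.1))) x
      ((S.contDiffOn_D₀ i j).contDiffAt ((isOpen_univ.prod S.isOpen_Ω).mem_nhds ⟨trivial, hq⟩))
      (hp.prodMk hconf)
  exact (contDiffAt_matrix_mul (contDiffAt_matrix_mul (fun i j => hQ j i) hD) hQ i j).of_le
    (by exact_mod_cast le_top)

theorem contDiffAt_grad_momentum_Hd (l : Fin (r + 2) → ℝ) (x : (Fin (r + 2) → ℝ) × (Fin 2 → ℝ))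
    (i : Fin 2) : ContDiffAt ℝ 1 (fun x : (Fin (r + 2) → ℝ) × (Fin 2 → ℝ) =>
      grad (fun p' => R.Hd l x.1 p') x.2 i) x := by
  refine contDiffAt_grad (g := fun x : (Fin (r + 2) → ℝ) × (Fin 2 → ℝ) => fun p' =>
    R.Hd l x.1 p') (q := Prod.snd) ?_ contDiffAt_snd i
  exact ContDiffAt.comp (g := fun y : (Fin (r + 2) → ℝ) × (Fin 2 → ℝ) => R.Hd l y.1 y.2)
    (f := fun y : ((Fin (r + 2) → ℝ) × (Fin 2 → ℝ)) × (Fin 2 → ℝ) => (y.1.1, y.2)) (x, x.2)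
    (R.contDiff_Hd l).contDiffAt ((contDiffAt_fst.comp _ contDiffAt_fst).prodMk contDiffAt_snd)

theorem contDiffAt_grad_position_Hd (l : Fin (r + 2) → ℝ) (x : (Fin (r + 2) → ℝ) × (Fin 2 → ℝ))
    (i : Fin (r + 2)) : ContDiffAt ℝ 1 (fun x : (Fin (r + 2) → ℝ) × (Fin 2 → ℝ) =>
      grad (fun w' => R.Hd l w' x.2) x.1 i) x := by
  refine contDiffAt_grad (g := fun x : (Fin (r + 2) → ℝ) × (Fin 2 → ℝ) => fun w' =>
    R.Hd l w' x.2) (q := Prod.fst) ?_ contDiffAt_fst i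
  exact ContDiffAt.comp (g := fun y : (Fin (r + 2) → ℝ) × (Fin 2 → ℝ) => R.Hd l y.1 y.2)
    (f := fun y : ((Fin (r + 2) → ℝ) × (Fin 2 → ℝ)) × (Fin (r + 2) → ℝ) => (y.2, y.1.2)) (x, x.1)
    (R.contDiff_Hd l).contDiffAt (contDiffAt_snd.prodMk (contDiffAt_snd.comp _ contDiffAt_fst))

theorem contDiffAt_injectedDamping (Dhat : Matrix (Fin 2) (Fin 2) ℝ) (k : ℝ)
    {w : Fin (r + 2) → ℝ} (hw : w 0 ≠ 0) (i j : Fin 2) :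
    ContDiffAt ℝ 1 (fun w => R.injectedDamping Dhat k w i j) w := by
  have hw0 : ContDiffAt ℝ 1 (fun w : Fin (r + 2) → ℝ => k / w 0 ^ 2) w :=
    contDiffAt_const.div (by fun_prop) (pow_ne_zero 2 hw)
  have hQ := R.contDiffAt_Qw hw
  have h1 : ∀ i j, ContDiffAt ℝ 1
      (fun w => ((R.Qw w)ᵀ * Matrix.vecMulVec (e₁ r) (e₁ r)) i j) w :=
    contDiffAt_matrix_mul (A := fun w => (R.Qw w)ᵀ)
      (B := fun _ => Matrix.vecMulVec (e₁ r) (e₁ r)) (fun i j => hQ j i) fun _ _ => contDiffAt_const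
  have h2 := contDiffAt_matrix_mul h1 hQ i j
  simp only [injectedDamping, Matrix.add_apply, Matrix.smul_apply, smul_eq_mul]
  exact contDiffAt_const.add (hw0.mul h2)

/-- The condition `w₁ ≠ 0` enters only through `Q_w` and the factor `k / w₁²`; the other ingredients
are regular everywhere. -/
theorem contDiffAt_closedLoop (l : Fin (r + 2) → ℝ) (Dhat : Matrix (Fin 2) (Fin 2) ℝ) (k : ℝ)
    {x : (Fin (r + 2) → ℝ) × (Fin 2 → ℝ)} (hx : x.1 0 ≠ 0) :
    ContDiffAt ℝ 1
      (fun x : (Fin (r + 2) → ℝ) × (Fin 2 → ℝ) => R.closedLoop l Dhat k x.1 x.2) x := by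
  have hQ : ∀ i j, ContDiffAt ℝ 1
      (fun x : (Fin (r + 2) → ℝ) × (Fin 2 → ℝ) => R.Qw x.1 i j) x := fun i j =>
    ContDiffAt.comp (g := fun w => R.Qw w i j) x (R.contDiffAt_Qw hx i j) contDiffAt_fst
  have hI : ∀ i j, ContDiffAt ℝ 1
      (fun x : (Fin (r + 2) → ℝ) × (Fin 2 → ℝ) => R.injectedDamping Dhat k x.1 i j) x := fun i j =>
    ContDiffAt.comp (g := fun w => R.injectedDamping Dhat k w i j) x
      (R.contDiffAt_injectedDamping Dhat k hx i j) contDiffAt_fst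
  have hD : ∀ i j, ContDiffAt ℝ 1 (fun x : (Fin (r + 2) → ℝ) × (Fin 2 → ℝ) =>
      (R.Cw x.1 x.2 - R.Dd Dhat k x.1 x.2) i j) x := fun i j => by
    simp only [Dd, Matrix.sub_apply, Matrix.add_apply]
    exact (R.contDiffAt_Cw x i j).sub ((R.contDiffAt_Dw x i j).add (hI i j))
  have hv := R.contDiffAt_grad_momentum_Hd l x
  unfold closedLoop
  refine ContDiffAt.prodMk (contDiffAt_pi.2 (contDiffAt_matrix_mulVec hQ hv))
    (contDiffAt_pi.2 fun i => ?_)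
  simp only [Pi.add_apply, Pi.neg_apply]
  exact (contDiffAt_matrix_mulVec (fun i j => hQ j i)
    (R.contDiffAt_grad_position_Hd l x) i).neg.add (contDiffAt_matrix_mulVec hD hv i)

/-! ### Compact sublevel sets and the energy balance -/

theorem kinetic_nonneg (w : Fin (r + 2) → ℝ) (p : Fin 2 → ℝ) :
    0 ≤ p ⬝ᵥ ((R.Mw w)⁻¹ *ᵥ p) := by
  simpa using (R.posDef_Mw w).inv.posSemidef.dotProduct_mulVec_nonneg p

theorem mul_sq_le_dotProduct_diagonal {m : ℕ} {l : Fin m → ℝ} (hl : ∀ i, 0 < l i)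
    (w : Fin m → ℝ) (i : Fin m) : l i * w i ^ 2 ≤ w ⬝ᵥ (Matrix.diagonal l *ᵥ w) := by
  have h : w ⬝ᵥ (Matrix.diagonal l *ᵥ w) = ∑ j, l j * w j ^ 2 := by
    simp only [dotProduct, Matrix.mulVec_diagonal]
    exact Finset.sum_congr rfl fun j _ => by ring
  rw [h]
  exact Finset.single_le_sum (f := fun j => l j * w j ^ 2)
    (fun j _ => mul_nonneg (hl j).le (sq_nonneg _)) (Finset.mem_univ i)

theorem Hd_nonneg {l : Fin (r + 2) → ℝ} (hl : ∀ i, 0 < l i) (w : Fin (r + 2) → ℝ)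
    (p : Fin 2 → ℝ) : 0 ≤ R.Hd l w p := by
  have h1 := R.kinetic_nonneg w p
  have h2 : 0 ≤ w ⬝ᵥ (Matrix.diagonal l *ᵥ w) :=
    (mul_nonneg (hl 0).le (sq_nonneg _)).trans (mul_sq_le_dotProduct_diagonal hl w 0)
  unfold Hd
  linarith

/-- The potential confines `w` to a box, since `lᵢ wᵢ² ≤ 2h`. The diagonal of `M_w` is bounded on
this box, and `sq_le_diag_mul_inv_quadratic` then bounds `p`. -/
theorem isCompact_sublevel_Hd {l : Fin (r + 2) → ℝ} (hl : ∀ i, 0 < l i) (h : ℝ) :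
    IsCompact {x : (Fin (r + 2) → ℝ) × (Fin 2 → ℝ) | R.Hd l x.1 x.2 ≤ h} := by
  let K : Set (Fin (r + 2) → ℝ) := univ.pi fun i => Icc (-√(2 * h / l i)) (√(2 * h / l i))
  have hK : IsCompact K := isCompact_univ_pi fun i => isCompact_Icc
  have hB : ∀ i : Fin 2, ∃ B, ∀ w ∈ K, ‖R.Mw w i i‖ ≤ B := fun i =>
    hK.exists_bound_of_continuousOn (R.contDiff_Mw i i).continuous.continuousOn
  choose B hB using hB
  have hL : IsCompact (univ.pi fun i => Icc (-√(B i * (2 * h))) (√(B i * (2 * h))) :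
      Set (Fin 2 → ℝ)) := isCompact_univ_pi fun i => isCompact_Icc
  refine (hK.prod hL).of_isClosed_subset
    (isClosed_le (R.contDiff_Hd l).continuous continuous_const) ?_
  rintro ⟨w, p⟩ (hwp : R.Hd l w p ≤ h)
  have hkin := R.kinetic_nonneg w p
  have hdiag := mul_sq_le_dotProduct_diagonal hl w
  unfold Hd at hwp
  have hw : w ∈ K := fun i _ => by
    refine abs_le.1 (Real.abs_le_sqrt ?_)
    rw [le_div_iff₀ (hl i)]
    linarith [hdiag i]
  refine ⟨hw, fun i _ => abs_le.1 (Real.abs_le_sqrt ?_)⟩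
  have h0 : 0 ≤ l 0 * w 0 ^ 2 := mul_nonneg (hl 0).le (sq_nonneg _)
  have hMB : R.Mw w i i ≤ B i := (le_abs_self _).trans (hB i w hw)
  have hB0 : 0 ≤ B i := (norm_nonneg _).trans (hB i w hw)
  calc p i ^ 2 ≤ R.Mw w i i * (p ⬝ᵥ ((R.Mw w)⁻¹ *ᵥ p)) :=
        sq_le_diag_mul_inv_quadratic (R.posDef_Mw w) p i
    _ ≤ B i * (p ⬝ᵥ ((R.Mw w)⁻¹ *ᵥ p)) := by gcongr
    _ ≤ B i * (2 * h) := by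
      gcongr
      linarith [hdiag 0]

theorem dotProduct_injectedDamping (Dhat : Matrix (Fin 2) (Fin 2) ℝ) (k : ℝ)
    (w : Fin (r + 2) → ℝ) (v : Fin 2 → ℝ) :
    v ⬝ᵥ (R.injectedDamping Dhat k w *ᵥ v) =
      v ⬝ᵥ (Dhat *ᵥ v) + k * ((R.Qw w *ᵥ v) 0 / w 0) ^ 2 := by
  have h : v ⬝ᵥ (((R.Qw w)ᵀ * Matrix.vecMulVec (e₁ r) (e₁ r) * R.Qw w) *ᵥ v) =
      ((R.Qw w *ᵥ v) 0) ^ 2 := by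
    rw [← Matrix.mulVec_mulVec, ← Matrix.mulVec_mulVec, Matrix.dotProduct_mulVec,
      Matrix.vecMul_transpose, Matrix.vecMulVec_mulVec]
    simp [e₁, sq]
  rw [injectedDamping, Matrix.add_mulVec, dotProduct_add, Matrix.smul_mulVec, dotProduct_smul, h,
    smul_eq_mul]
  ring

/-- The energy balance of the closed loop. -/
theorem fderiv_Hd_closedLoop (l : Fin (r + 2) → ℝ) (Dhat : Matrix (Fin 2) (Fin 2) ℝ) (k : ℝ)
    (x : (Fin (r + 2) → ℝ) × (Fin 2 → ℝ)) :
    fderiv ℝ (fun x : (Fin (r + 2) → ℝ) × (Fin 2 → ℝ) => R.Hd l x.1 x.2) x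
      (R.closedLoop l Dhat k x.1 x.2) =
    -(((R.Mw x.1)⁻¹ *ᵥ x.2) ⬝ᵥ (R.Dw x.1 x.2 *ᵥ ((R.Mw x.1)⁻¹ *ᵥ x.2)))
      - ((R.Mw x.1)⁻¹ *ᵥ x.2) ⬝ᵥ (Dhat *ᵥ ((R.Mw x.1)⁻¹ *ᵥ x.2))
      - k * ((R.closedLoop l Dhat k x.1 x.2).1 0 / x.1 0) ^ 2 := by
  obtain ⟨w, p⟩ := x
  have hC := dotProduct_mulVec_eq_zero_of_transpose_eq_neg
    (R.transpose_C p (R.fz.symm (fwInv w))) ((R.Mw w)⁻¹ *ᵥ p)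
  simp only [closedLoop]
  rw [fderiv_uncurry_apply ((R.contDiff_Hd l).differentiable (by simp)), grad_momentum_Hd]
  set v := (R.Mw w)⁻¹ *ᵥ p
  set g := grad (fun w' => R.Hd l w' p) w
  have hg : v ⬝ᵥ ((R.Qw w)ᵀ *ᵥ g) = g ⬝ᵥ (R.Qw w *ᵥ v) := by
    rw [Matrix.dotProduct_mulVec, Matrix.vecMul_transpose, dotProduct_comm]
  change v ⬝ᵥ (R.Cw w p *ᵥ v) = 0 at hC
  rw [dotProduct_add, dotProduct_neg, hg, Matrix.sub_mulVec, dotProduct_sub, hC, Dd,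
    Matrix.add_mulVec, dotProduct_add, dotProduct_injectedDamping]
  ring

theorem dotProduct_Dw_nonneg (w : Fin (r + 2) → ℝ) (p v : Fin 2 → ℝ) :
    0 ≤ v ⬝ᵥ (R.Dw w p *ᵥ v) := by
  simpa only [star_trivial] using!
    (R.posSemidef_D (R.fz_symm_mem (fwInv w)) p).dotProduct_mulVec_nonneg v

theorem fderiv_Hd_closedLoop_le (l : Fin (r + 2) → ℝ) {Dhat : Matrix (Fin 2) (Fin 2) ℝ}
    (hDhat : Dhat.PosDef) (k : ℝ) (x : (Fin (r + 2) → ℝ) × (Fin 2 → ℝ)) :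
    fderiv ℝ (fun x : (Fin (r + 2) → ℝ) × (Fin 2 → ℝ) => R.Hd l x.1 x.2) x
      (R.closedLoop l Dhat k x.1 x.2) ≤
      -k * ((R.closedLoop l Dhat k x.1 x.2).1 0 / x.1 0) ^ 2 := by
  rw [fderiv_Hd_closedLoop]
  have h1 := R.dotProduct_Dw_nonneg x.1 x.2 ((R.Mw x.1)⁻¹ *ᵥ x.2)
  have h2 : 0 ≤ ((R.Mw x.1)⁻¹ *ᵥ x.2) ⬝ᵥ (Dhat *ᵥ ((R.Mw x.1)⁻¹ *ᵥ x.2)) := by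
    simpa using hDhat.posSemidef.dotProduct_mulVec_nonneg ((R.Mw x.1)⁻¹ *ᵥ x.2)
  linarith

theorem momentum_eq_zero_of_fderiv_Hd_eq_zero (l : Fin (r + 2) → ℝ)
    {Dhat : Matrix (Fin 2) (Fin 2) ℝ} (hDhat : Dhat.PosDef) {k : ℝ} (hk : 0 < k)
    {x : (Fin (r + 2) → ℝ) × (Fin 2 → ℝ)}
    (h : fderiv ℝ (fun x : (Fin (r + 2) → ℝ) × (Fin 2 → ℝ) => R.Hd l x.1 x.2) x
      (R.closedLoop l Dhat k x.1 x.2) = 0) : x.2 = 0 := by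
  rw [fderiv_Hd_closedLoop] at h
  have h1 := R.dotProduct_Dw_nonneg x.1 x.2 ((R.Mw x.1)⁻¹ *ᵥ x.2)
  have h3 : 0 ≤ k * ((R.closedLoop l Dhat k x.1 x.2).1 0 / x.1 0) ^ 2 := by positivity
  have hv : (R.Mw x.1)⁻¹ *ᵥ x.2 = 0 := by
    by_contra hv
    have h2 : 0 < ((R.Mw x.1)⁻¹ *ᵥ x.2) ⬝ᵥ (Dhat *ᵥ ((R.Mw x.1)⁻¹ *ᵥ x.2)) := by
      simpa using hDhat.dotProduct_mulVec_pos hv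
    linarith
  have hdet : IsUnit (R.Mw x.1).det := isUnit_iff_ne_zero.2 (R.posDef_Mw x.1).det_pos.ne'
  rw [← Matrix.one_mulVec x.2, ← Matrix.mul_nonsing_inv _ hdet, ← Matrix.mulVec_mulVec, hv,
    Matrix.mulVec_zero]

/-! ### The chained structure and the absence of equilibria -/

/-- The chained structure in terms of velocities. -/
theorem Qz_mulVec_chained (hR : R.HasChainedStructure) (z : Fin (r + 2) → ℝ) (η : Fin 2 → ℝ)
    (j : Fin r) : (R.Qz z *ᵥ η) j.succ.succ = z j.castSucc.succ * (R.Qz z *ᵥ η) 0 := by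
  have h : (chainedAnnihilator z *ᵥ (R.Qz z *ᵥ η)) j = 0 := by
    rw [Matrix.mulVec_mulVec, hR z, Matrix.zero_mulVec, Pi.zero_apply]
  generalize R.Qz z *ᵥ η = ζ at h ⊢
  simp only [Matrix.mulVec, dotProduct, chainedAnnihilator, Matrix.of_apply] at h
  rw [Fin.sum_univ_succ] at h
  simp [Fin.succ_ne_zero] at h
  linarith

theorem Qz_mulVec_injective (z : Fin (r + 2) → ℝ) : Function.Injective (R.Qz z).mulVec := by
  have hq := R.fz_symm_mem z
  have hd : fderiv ℝ R.fz.symm (R.fz (R.fz.symm z)) ∘L fderiv ℝ R.fz (R.fz.symm z) =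
      ContinuousLinearMap.id ℝ _ := by
    have h1 : DifferentiableAt ℝ R.fz (R.fz.symm z) :=
      (R.contDiffAt_fz hq).differentiableAt (by simp)
    have h2 : DifferentiableAt ℝ R.fz.symm (R.fz (R.fz.symm z)) :=
      R.contDiff_fz_symm.differentiable (by simp) _
    rw [← fderiv_comp _ h2 h1, ← fderiv_id (𝕜 := ℝ) (x := R.fz.symm z)]
    refine Filter.EventuallyEq.fderiv_eq ?_
    filter_upwards [S.isOpen_Ω.mem_nhds hq] with q hq'
    exact R.fz.left_inv (by rwa [R.source_fz])
  intro η η' h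
  refine R.Q_mulVec_injective hq ?_
  simp only [Qz, ← Matrix.mulVec_mulVec, jacobian_mulVec] at h
  have := congrArg (fderiv ℝ R.fz.symm (R.fz (R.fz.symm z))) h
  simpa only [← ContinuousLinearMap.comp_apply, hd, ContinuousLinearMap.id_apply] using this

/-- The first two components of the velocity can be prescribed. -/
theorem exists_Qz_mulVec_eq (hR : R.HasChainedStructure) (z : Fin (r + 2) → ℝ) (a b : ℝ) :
    ∃ η : Fin 2 → ℝ, (R.Qz z *ᵥ η) 0 = a ∧ (R.Qz z *ᵥ η) 1 = b := by
  let A : Matrix (Fin 2) (Fin 2) ℝ := Matrix.of ![R.Qz z 0, R.Qz z 1]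
  -- The remaining rows of `Q_z` are multiples of the first, so the kernel of the top block `A` is
  -- that of `Q_z`.
  have hinj : Function.Injective A.mulVecLin := by
    rw [← LinearMap.ker_eq_bot, LinearMap.ker_eq_bot']
    intro η hη
    have h0 : (R.Qz z *ᵥ η) 0 = 0 := congrFun hη 0
    have h1 : (R.Qz z *ᵥ η) 1 = 0 := congrFun hη 1
    refine R.Qz_mulVec_injective z ?_
    rw [Matrix.mulVec_zero]
    funext j
    refine Fin.cases h0 (fun j => Fin.cases h1 (fun j => ?_) j) j
    rw [R.Qz_mulVec_chained hR, h0, mul_zero, Pi.zero_apply]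
  obtain ⟨η, hη⟩ := LinearMap.injective_iff_surjective.1 hinj ![a, b]
  exact ⟨η, congrFun hη 0, congrFun hη 1⟩

/-- `Q_w` is defined through the Jacobian of the implicitly given `fw`. The chain rule trades it for
the explicit derivative of the polynomial map `fwInv`. -/
theorem fderiv_fwInv_Qw_mulVec {w : Fin (r + 2) → ℝ} (hw : w 0 ≠ 0) (η : Fin 2 → ℝ) :
    fderiv ℝ fwInv w (R.Qw w *ᵥ η) = R.Qz (fwInv w) *ᵥ η := by
  have hz : fwInv w 0 ≠ 0 := by rwa [fwInv_zero]
  have hd : fderiv ℝ fwInv (fw (fwInv w)) ∘L fderiv ℝ fw (fwInv w) =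
      ContinuousLinearMap.id ℝ _ := by
    have h1 : DifferentiableAt ℝ fw (fwInv w) :=
      (contDiffAt_fw (n := 1) hz).differentiableAt (by simp)
    have h2 : DifferentiableAt ℝ fwInv (fw (fwInv w)) :=
      contDiff_fwInv.differentiable (n := 1) (by simp) _
    rw [← fderiv_comp _ h2 h1, ← fderiv_id (𝕜 := ℝ) (x := fwInv w)]
    refine Filter.EventuallyEq.fderiv_eq ?_
    exact ((isOpen_ne_fun (continuous_apply 0) continuous_const).eventually_mem hz).mono
      fun z hz => fwInv_fw hz
  rw [fw_fwInv hw] at hd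
  rw [Qw, ← Matrix.mulVec_mulVec, jacobian_mulVec, ← ContinuousLinearMap.comp_apply, hd]
  rfl

/-- The shaped potential has no critical point along the admissible directions. -/
theorem transpose_Qw_mulVec_ne_zero (hR : R.HasChainedStructure) {l : Fin (r + 2) → ℝ}
    (hl : ∀ i, 0 < l i) {w : Fin (r + 2) → ℝ} (hw : w 0 ≠ 0) :
    (R.Qw w)ᵀ *ᵥ (Matrix.diagonal l *ᵥ w) ≠ 0 := by
  intro h
  have horth : ∀ η, ∑ i, l i * w i * (R.Qw w *ᵥ η) i = 0 := fun η => by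
    have : (Matrix.diagonal l *ᵥ w) ⬝ᵥ (R.Qw w *ᵥ η) = 0 := by
      rw [Matrix.dotProduct_mulVec, ← Matrix.mulVec_transpose, h, zero_dotProduct]
    simpa [dotProduct, Matrix.mulVec_diagonal] using this
  have hdir : ∀ η, ∀ j, fderiv ℝ fwInv w (R.Qw w *ᵥ η) j = (R.Qz (fwInv w) *ᵥ η) j :=
    fun η j => congrFun (R.fderiv_fwInv_Qw_mulVec hw η) j
  have hfirst : ∀ η, (R.Qw w *ᵥ η) 0 = (R.Qz (fwInv w) *ᵥ η) 0 := fun η => by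
    rw [← hdir, fderiv_fwInv, fwMatrix_mulVec]
    simp
  have hchain : ∀ η, w 1 * (R.Qw w *ᵥ η) 0 = 0 → ∀ i : Fin r, (R.Qw w *ᵥ η) i.succ.succ = 0 :=
    fun η hη => eq_zero_of_fderiv_fwInv_chained hw
      (fun j => by rw [hdir, R.Qz_mulVec_chained hR, hfirst]) hη
  -- An admissible direction with `ξ₁ = 0` and `ż₂ = 1` moves only `w₂`; orthogonality to `L w` then
  -- forces `w₂ = 0`.
  have hw1 : w 1 = 0 := by
    obtain ⟨η, h0, h1⟩ := R.exists_Qz_mulVec_eq hR (fwInv w) 0 1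
    have hξ0 : (R.Qw w *ᵥ η) 0 = 0 := (hfirst η).trans h0
    have hξ := hchain η (by rw [hξ0, mul_zero])
    have hξ1 : w 0 * (R.Qw w *ᵥ η) 1 = 1 := by
      have := hdir η 1
      rw [h1, fderiv_fwInv, fwMatrix_mulVec, hξ0] at this
      simpa [hξ] using this
    have hsum := horth η
    rw [Fin.sum_univ_succ, Fin.sum_univ_succ] at hsum
    simp only [hξ, hξ0, mul_zero, Finset.sum_const_zero, add_zero, zero_add,
      Fin.succ_zero_eq_one] at hsum
    have hne : (R.Qw w *ᵥ η) 1 ≠ 0 := fun h => by simp [h] at hξ1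
    rcases mul_eq_zero.1 hsum with h | h
    · exact (mul_eq_zero.1 h).resolve_left (hl 1).ne'
    · exact absurd h hne
  -- With `w₂ = 0`, a direction with `ξ₁ = 1` leaves `w₃, …, wₙ` fixed, and orthogonality reads `l₁
  -- w₁ = 0`.
  obtain ⟨η, h0, -⟩ := R.exists_Qz_mulVec_eq hR (fwInv w) 1 0
  have hξ0 : (R.Qw w *ᵥ η) 0 = 1 := (hfirst η).trans h0
  have hξ := hchain η (by rw [hw1, zero_mul])
  have hsum := horth η
  rw [Fin.sum_univ_succ, Fin.sum_univ_succ] at hsum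
  simp only [hξ, hξ0, hw1, mul_zero, zero_mul, Finset.sum_const_zero, add_zero, mul_one,
    Fin.succ_zero_eq_one] at hsum
  exact (mul_ne_zero (hl 0).ne' hw) hsum

/-- At `p = 0` the kinetic, gyroscopic and damping terms vanish, leaving only the force `-Q_wᵀ L w`
of the shaped potential. -/
theorem closedLoop_snd_ne_zero (hR : R.HasChainedStructure) {l : Fin (r + 2) → ℝ}
    (hl : ∀ i, 0 < l i) (Dhat : Matrix (Fin 2) (Fin 2) ℝ) (k : ℝ) {w : Fin (r + 2) → ℝ}
    (hw : w 0 ≠ 0) : (R.closedLoop l Dhat k w 0).2 ≠ 0 := by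
  have hkin : grad (fun w' => 1 / 2 * ((0 : Fin 2 → ℝ) ⬝ᵥ ((R.Mw w')⁻¹ *ᵥ (0 : Fin 2 → ℝ)))) w =
      0 := by
    funext i
    simp [grad]
  simp only [closedLoop]
  rw [grad_momentum_Hd, grad_position_Hd, hkin, Matrix.mulVec_zero, Matrix.mulVec_zero, add_zero,
    zero_add]
  exact neg_ne_zero.2 (R.transpose_Qw_mulVec_ne_zero hR hl hw)

end Coordinates

/-! ### Return to the coordinates `z` and conclusion -/

/-- Along a bounded curve, `z = fwInv w` tends to zero together with `w₁`. -/
theorem tendsto_fwInv_zero {r : ℕ} {α : Type*} {F : Filter α} {w : α → Fin (r + 2) → ℝ}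
    (h0 : Tendsto (fun t => w t 0) F (𝓝 0)) {K : Set (Fin (r + 2) → ℝ)} (hK : IsCompact K)
    (hw : ∀ᶠ t in F, w t ∈ K) : Tendsto (fun t => fwInv (w t)) F (𝓝 0) := by
  obtain ⟨B, hB⟩ := hK.isBounded.exists_norm_le
  have hbdd : ∀ i, IsBoundedUnder (· ≤ ·) F (norm ∘ fun t => w t i) := fun i =>
    ⟨B, eventually_map.2 (hw.mono fun t ht => (norm_le_pi_norm (w t) i).trans (hB _ ht))⟩
  have hterm : ∀ (c : ℝ) (m : ℕ) (i : Fin (r + 2)), 0 < m →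
      Tendsto (fun t => c * w t 0 ^ m * w t i) F (𝓝 0) := fun c m i hm => by
    refine Tendsto.zero_mul_isBoundedUnder_le ?_ (hbdd i)
    simpa [hm.ne'] using (h0.pow m).const_mul c
  rw [tendsto_pi_nhds]
  intro j
  have hsum : ∀ m : ℕ, 0 < m → Tendsto (fun t => ∑ i : Fin r,
      1 / (Nat.factorial ((i : ℕ) + m) : ℝ) * w t 0 ^ ((i : ℕ) + m) * w t i.succ.succ) F (𝓝 0) :=
    fun m hm => by
      simpa using tendsto_finsetSum Finset.univ fun (i : Fin r) _ =>
        hterm (1 / (Nat.factorial ((i : ℕ) + m) : ℝ)) ((i : ℕ) + m) i.succ.succ (by omega)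
  simp only [fwInv]
  split_ifs with hj0 hj1
  · exact h0
  · have h1 := hterm 1 1 1 one_pos
    simp only [one_mul, pow_one] at h1
    simpa using h1.add (hsum 1 one_pos)
  · exact hsum j (Nat.pos_of_ne_zero fun h => hj0 (Fin.ext h))

end ChainedPH

theorem mainTheorem1 {r : ℕ} (S : ChainedPH.NonholonomicSystem r) (R : ChainedPH.Coordinates S)
    (hR : R.HasChainedStructure)
    (l : Fin (r + 2) → ℝ) (hl : ∀ i, 0 < l i)
    (Dhat : Matrix (Fin 2) (Fin 2) ℝ) (hDhat : Dhat.PosDef)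
    (k : ℝ) (hk : 0 < k) :
    -- the control law turns the open loop into the closed loop
    (∀ (w : Fin (r + 2) → ℝ) (p : Fin 2 → ℝ), w 0 ≠ 0 →
      R.openLoop w p (R.controlLaw l Dhat k w p) = R.closedLoop l Dhat k w p) ∧
    -- from `w₁(t₀) ≠ 0` there is exactly one solution, and it exists for all time
    (∀ (t₀ : ℝ) (x₀ : (Fin (r + 2) → ℝ) × (Fin 2 → ℝ)), x₀.1 0 ≠ 0 →
      ∃ x, R.IsSolutionOn l Dhat k (Set.Ici t₀) x ∧ x t₀ = x₀ ∧
        ∀ (T : ℝ) (y : ℝ → (Fin (r + 2) → ℝ) × (Fin 2 → ℝ)),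
          R.IsSolutionOn l Dhat k (Set.Ico t₀ T) y → y t₀ = x₀ → Set.EqOn y x (Set.Ico t₀ T)) ∧
    -- every solution with `w₁(t₀) ≠ 0` keeps `w₁ ≠ 0`, and `w₁ → 0` and `z → 0`
    (∀ (t₀ : ℝ) (x : ℝ → (Fin (r + 2) → ℝ) × (Fin 2 → ℝ)),
      R.IsSolutionOn l Dhat k (Set.Ici t₀) x → (x t₀).1 0 ≠ 0 →
        (∀ t ≥ t₀, (x t).1 0 ≠ 0) ∧
        Filter.Tendsto (fun t => (x t).1 0) Filter.atTop (nhds 0) ∧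
        Filter.Tendsto (fun t => ChainedPH.fwInv (x t).1) Filter.atTop (nhds 0)) := by
  let f : (Fin (r + 2) → ℝ) × (Fin 2 → ℝ) → (Fin (r + 2) → ℝ) × (Fin 2 → ℝ) :=
    fun x => R.closedLoop l Dhat k x.1 x.2
  let H : (Fin (r + 2) → ℝ) × (Fin 2 → ℝ) → ℝ := fun x => R.Hd l x.1 x.2
  let c : (Fin (r + 2) → ℝ) × (Fin 2 → ℝ) →L[ℝ] ℝ :=
    (ContinuousLinearMap.proj 0).comp (ContinuousLinearMap.fst ℝ _ _)
  have hH : ContDiff ℝ 1 H := (R.contDiff_Hd l).of_le (by exact_mod_cast le_top)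
  have hHd : Differentiable ℝ H := hH.differentiable (by simp)
  have hH0 : ∀ y, 0 ≤ H y := fun y => R.Hd_nonneg hl y.1 y.2
  have hdiss : ∀ y, c y ≠ 0 → fderiv ℝ H y (f y) ≤ -k * (c (f y) / c y) ^ 2 :=
    fun y _ => R.fderiv_Hd_closedLoop_le l hDhat k y
  have hf : ContDiffOn ℝ 1 f {y | c y ≠ 0} :=
    fun y hy => (R.contDiffAt_closedLoop l Dhat k hy).contDiffWithinAt
  have hU : IsOpen {y | c y ≠ 0} := isOpen_ne_fun c.continuous continuous_const
  have hcpt : ∀ h, IsCompact {y | H y ≤ h} := R.isCompact_sublevel_Hd hl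
  refine ⟨fun w p _ => R.openLoop_controlLaw l Dhat k w p, fun t₀ x₀ hx₀ => ?_,
    fun t₀ x hx hx₀ => ?_⟩
  · obtain ⟨x, hxt, hxc, hx⟩ := ChainedPH.exists_solution_of_singular_damping (a := t₀) hHd hH0 hk
      hdiss hf hcpt (x₀ := x₀) hx₀
    have hcont : ContinuousOn x (Ici t₀) := fun t ht => (hx t ht).continuousWithinAt
    refine ⟨x, ⟨hcont, fun t ht _ => hx t ht⟩, hxt, fun T y hy hyt t ht => ?_⟩
    have hsub : Icc t₀ t ⊆ Ico t₀ T := fun s hs => ⟨hs.1, hs.2.trans_lt ht.2⟩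
    have hyc : ContinuousOn y (Icc t₀ t) := hy.1.mono hsub
    have hy' : ∀ s ∈ Ico t₀ t, c (y s) ≠ 0 → HasDerivWithinAt y (f (y s)) (Ici s) s := by
      intro s hs hcs
      have hs' := hsub (Ico_subset_Icc_self hs)
      exact (hy.2 s hs' hcs).mono_of_mem_nhdsWithin
        (mem_of_superset (Ico_mem_nhdsGE hs'.2) (Ico_subset_Ico_left hs.1))
    -- A competing solution need only be continuous where `w₁ = 0`, so it must first be shown never
    -- to get there; uniqueness then applies on the open set `w₁ ≠ 0`.
    have hne := ChainedPH.ne_zero_of_singular_damping hHd hH0 hk hdiss hyc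
      (by rw [hyt]; exact hx₀) hy'
    exact ChainedPH.eqOn_Icc_of_contDiffOn hU hf hyc hne
      (fun s hs => hy' s hs (hne s (Ico_subset_Icc_self hs)))
      (hcont.mono fun s hs => hs.1) (fun s hs => hxc s hs.1)
      (fun s hs => (hx s hs.1).mono (Ici_subset_Ici.2 hs.1)) (hyt.trans hxt.symm) ⟨ht.1, le_rfl⟩
  · have hne : ∀ t ≥ t₀, c (x t) ≠ 0 := fun t ht =>
      ChainedPH.ne_zero_of_singular_damping hHd hH0 hk hdiss
        (hx.1.mono fun s (hs : s ∈ Icc t₀ t) => hs.1) hx₀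
        (fun s hs hcs => (hx.2 s hs.1 hcs).mono (Ici_subset_Ici.2 hs.1)) t ⟨ht, le_rfl⟩
    have hx' : ∀ t ≥ t₀, HasDerivWithinAt x (f (x t)) (Ici t) t := fun t ht =>
      (hx.2 t ht (hne t ht)).mono (Ici_subset_Ici.2 ht)
    have hlim : Tendsto (fun t => c (x t)) atTop (𝓝 0) :=
      ChainedPH.tendsto_zero_of_singular_damping (π := ContinuousLinearMap.snd ℝ _ _) hH hH0 hk
        hdiss hf.continuousOn hcpt
        (fun y _ hy => R.momentum_eq_zero_of_fderiv_Hd_eq_zero l hDhat hk hy)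
        (fun y hy hp => by
          obtain ⟨w, p⟩ := y
          obtain rfl : p = 0 := hp
          exact R.closedLoop_snd_ne_zero hR hl Dhat k hy)
        hx.1 hne hx'
    -- The compact set is the projection to `w` of the initial energy sublevel set, which the
    -- trajectory never leaves.
    refine ⟨hne, hlim, ChainedPH.tendsto_fwInv_zero hlim
      ((hcpt (H (x t₀))).image continuous_fst) ?_⟩
    filter_upwards [eventually_ge_atTop t₀] with t ht
    refine mem_image_of_mem Prod.fst (ChainedPH.energy_le hHd hk hdiss
      (hx.1.mono fun s (hs : s ∈ Icc t₀ t) => hs.1) (fun s hs => hne s hs.1)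
      (fun s hs => hx' s hs.1) t ⟨ht, le_rfl⟩)
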